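/- Let $\{X_t\}_{t\in\mathbb Z}$ be a real-valued centered second-order stationary process on a probability space, with $\operatorname{var}X_0>0$. For $K\subset\mathbb Z$ let $V_K$ be the closed linear span of $\{X_k:k\in K\}$ in $L^2$, let $P_K$ be the orthogonal projection onto $V_K$, and write $\|\cdot\|$ for the $L^2$-norm. Assume that $\{X_t\}$ is purely nondeterministic, that is, $\bigcap_{n\in\mathbb Z}V_{(-\infty,n]}=\{0\}$. Let $\varepsilon_t=X_t-P_{(-\infty,t-1]}X_t$, let $\{\psi_j\}_{j\ge0}$ ($\psi_0=1$) be the MA coefficients in the Wold decomposition $X_t=\sum_{j\ge0}\psi_j\varepsilon_{t-j}$, and let $\{\phi_j\}_{j\ge0}$ ($\phi_0=-1$) be the AR coefficients, given by $\bigl(\sum_{j\ge0}\psi_jz^j\bigr)^{-1}=-\sum_{j\ge0}\phi_jz^j$. Assume $(\mathrm{SM}_\alpha)$ for some $\alpha\ge0$: $$\sum_{j\ge0}(1+j)^\alpha|\psi_j|<\infty\quad\text{and}\quad\sum_{j\ge0}(1+j)^\alpha|\phi_j|<\infty .$$ For real filter coefficients $\{h_k\}_{k\in\mathbb Z}$ and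 $n\ge1$ let $Y_n=\sum_{k\in\mathbb Z}h_kX_{n-k}$, $\widehat Y_n=P_{(-\infty,n]}Y_n=\sum_{k=1}^\infty\hat h_kX_{n+1-k}$ (with coefficients $\hat h_k$ that do not depend on $n$), $\widehat Y_n^{(n)}=P_{\{1,\dots,n\}}Y_n$ and $\widetilde Y_n^{(n)}=\sum_{k=1}^n\hat h_kX_{n+1-k}$, and set $$\widetilde\sigma_n=\|\widehat Y_n^{(n)}-\widetilde Y_n^{(n)}\|,\qquad \sigma_n=\|\widehat Y_n^{(n)}-\widehat Y_n\| .$$ (i) If $\sum_{k\in\mathbb Z}|h_k|<\infty$, then the series $Y_n$ converges unconditionally in $L^2$, the coefficients $\{\hat h_k\}$ exist and are unique, and as $n\to\infty$ $$\widetilde\sigma_n=o(n^{-\alpha})+O\Bigl(\sum_{k\ge n}|h_k|\Bigr)\quad\text{and}\quad\sigma_n=o(n^{-\alpha})+O\Bigl(\sum_{k\ge n}|h_k|\Bigr).$$ (ii) If $\alpha\ge1$ and $\sum_{k\in\mathbb Z}h_k^2<\infty$, then again the series $Y_n$ converges unconditionally in $L^2$, the coefficients $\{\hat h_k\}$ exist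 and are unique, and as $n\to\infty$ $$\widetilde\sigma_n=o(n^{-\alpha+1})+O\Bigl(\sup_{k\ge n}|h_k|\Bigr)\quad\text{and}\quad\sigma_n=o(n^{-\alpha+1})+O\Bigl(\Bigl(\sum_{k\ge n}h_k^2\Bigr)^{1/2}\Bigr).$$ -/

import Mathlib

open MeasureTheory ProbabilityTheory Filter Topology Asymptotics

noncomputable section

namespace CausalFilter

/-- A univariate centered second-order stationary process indexed by `ℤ`. -/
structure IsCenteredStationary {Ω : Type*} [MeasurableSpace Ω] (P : Measure Ω)
    (X : ℤ → Ω → ℝ) : Prop where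
  memLp : ∀ t, MemLp (X t) 2 P
  mean_zero : ∀ t, ∫ ω, X t ω ∂P = 0
  cov_shift : ∀ s t r, cov[X (s + r), X (t + r); P] = cov[X s, X t; P]

/-- The process as a sequence in the real Hilbert space `L²(P)`. -/
def IsCenteredStationary.toL2 {Ω : Type*} [MeasurableSpace Ω] {P : Measure Ω}
    {X : ℤ → Ω → ℝ} (hX : IsCenteredStationary P X) (t : ℤ) : Lp ℝ 2 P :=
  (hX.memLp t).toLp (X t)

section Hilbert

variable {E : Type*} [NormedAddCommGroup E] [InnerProductSpace ℝ E]

/-- `V_K`, the closed linear span of `{x k : k ∈ K}`. -/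
abbrev closedSpan (x : ℤ → E) (K : Set ℤ) : Submodule ℝ E :=
  (Submodule.span ℝ (x '' K)).topologicalClosure

/-- Purely nondeterministic: the remote past `⋂ₙ V_{(-∞,n]}` is `{0}`. -/
def IsPurelyNondeterministic (x : ℤ → E) : Prop :=
  ⨅ n : ℤ, closedSpan x (Set.Iic n) = ⊥

/-- The target `Y_n = ∑_{k ∈ ℤ} h_k x_{n-k}` (sum in norm). -/
def target (x : ℤ → E) (h : ℤ → ℝ) (n : ℤ) : E :=
  ∑' k : ℤ, h k • x (n - k)

variable [CompleteSpace E]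

/-- The best linear predictor `P_K y`: orthogonal projection of `y` onto `V_K`. -/
def bestPredictor (x : ℤ → E) (K : Set ℤ) (y : E) : E :=
  (closedSpan x K).starProjection y

/-- The one-step innovation `ε_t = x_t - P_{(-∞,t-1]} x_t`. -/
def innovation (x : ℤ → E) (t : ℤ) : E :=
  x t - bestPredictor x (Set.Iio t) (x t)

/-- The MA coefficients `ψ_j` of the Wold decomposition `x_t = ∑_{j ≥ 0} ψ_j ε_{t-j}`: as the
innovations are orthogonal, `ψ_j = ⟨x_0, ε_{-j}⟩ / ‖ε_{-j}‖²` (by stationarity, time `0` may be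
replaced by any other time). In particular `ψ_0 = 1`. -/
def maCoeff (x : ℤ → E) (j : ℕ) : ℝ :=
  inner ℝ (x 0) (innovation x (-(j : ℤ))) / ‖innovation x (-(j : ℤ))‖ ^ 2

/-- The AR coefficients `φ_j`, defined by `1 / ∑ ψ_j z^j = - ∑ φ_j z^j`, so that `φ_0 = -1`. -/
def arCoeff (x : ℤ → E) (j : ℕ) : ℝ :=
  - PowerSeries.coeff j (PowerSeries.mk (maCoeff x))⁻¹

/-- The short memory condition `(SM_α)`. -/
structure IsShortMemory (x : ℤ → E) (α : ℝ) : Prop where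
  purelyNondeterministic : IsPurelyNondeterministic x
  summable_ma : Summable fun j : ℕ => (1 + (j : ℝ)) ^ α * |maCoeff x j|
  summable_ar : Summable fun j : ℕ => (1 + (j : ℝ)) ^ α * |arCoeff x j|

/-- `g` is the sequence of optimal causal filter coefficients, with `g j = ĥ_{j+1}`: for every
`n ≥ 1` the series `∑_{k=1}^∞ ĥ_k x_{n+1-k}` converges in norm to `P_{(-∞,n]} Y_n`. -/
def IsOptimalCausalFilter (x : ℤ → E) (h : ℤ → ℝ) (g : ℕ → ℝ) : Prop :=
  ∀ n : ℕ, 1 ≤ n →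
    Tendsto (fun N : ℕ => ∑ j ∈ Finset.range N, g j • x ((n : ℤ) - j)) atTop
      (𝓝 (bestPredictor x (Set.Iic (n : ℤ)) (target x h n)))

/-- `σ̃_n = ‖P_{[1,n]} Y_n - ∑_{k=1}^n ĥ_k x_{n+1-k}‖`, where `g j = ĥ_{j+1}`. -/
def sigmaTilde (x : ℤ → E) (h : ℤ → ℝ) (g : ℕ → ℝ) (n : ℕ) : ℝ :=
  ‖bestPredictor x (Set.Icc 1 (n : ℤ)) (target x h n)
    - ∑ j ∈ Finset.range n, g j • x ((n : ℤ) - j)‖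

/-- `σ_n = ‖P_{[1,n]} Y_n - P_{(-∞,n]} Y_n‖`. -/
def sigma (x : ℤ → E) (h : ℤ → ℝ) (n : ℕ) : ℝ :=
  ‖bestPredictor x (Set.Icc 1 (n : ℤ)) (target x h n)
    - bestPredictor x (Set.Iic (n : ℤ)) (target x h n)‖

end Hilbert

/-- `s_n = o(u_n) + O(v_n)` as `n → ∞`. -/
def IsLittleOAddBigO (s u v : ℕ → ℝ) : Prop :=
  ∃ a b : ℕ → ℝ, a =o[atTop] u ∧ b =O[atTop] v ∧ ∀ n, s n = a n + b n

end CausalFilter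

end

/-! Everything is done for a stationary sequence `x` in a Hilbert space. Split `Y_n` into its past
`∑_{k≥0} h_k x_{n-k}`, which the projection onto `V_{(-∞,n]}` fixes, and its future. By Wold,
`x_{n+m+1}` is predicted by `∑_i ψ_{m+1+i} ε_{n-i}`. Summing over `m` against `h` gives a causal
series in the innovations, with coefficients `futureMA`. Substituting `ε_t = -∑_l φ_l x_{t-l}` turns
it into a filter `a` (`futureFilter`) in `x` itself, so `ĥ_{k+1} = h_k + a_k`.

Dropping the terms `k ≥ n` leaves the error `∑_k h_{n+k} x_{-k} + ∑_k a_{n+k} x_{-k}`. Its norm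
bounds `σ_n`, by minimality of projections, and the norm of its projection onto `V_{[1,n]}` is
`σ̃_n`. The `a`-part is `o(n^{-β})` because `∑ (1+k)^β |a_k| < ∞`, with `β = α` for absolutely
summable `h` and `β = α - 1` for square summable `h`. The `h`-part is bounded by an `ℓ¹` or an `ℓ²`
norm of the tail of `h`.

Only the supremum bound for `σ̃_n` needs more (`exists_norm_bestPredictor_Icc_le`): the coefficients
of the projection are controlled by a bounded biorthogonal system (`exists_dual`), and the
correlations of the tail with `x_1, x_2, …` are summable when `∑ j |ψ_j| < ∞`. The same biorthogonal
system makes `ĥ` unique. -/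

noncomputable section

namespace CausalFilter

/-! ### Projections, innovations and the Wold decomposition. -/

section Geometry

variable {E : Type*} [NormedAddCommGroup E] [InnerProductSpace ℝ E]

/-- Weak stationarity: the Gram matrix of the sequence is invariant under shifts. -/
def IsStationarySeq (x : ℤ → E) : Prop :=
  ∀ s t r : ℤ, inner ℝ (x (s + r)) (x (t + r)) = inner ℝ (x s) (x t)

lemma IsStationarySeq.norm_eq {x : ℤ → E} (hx : IsStationarySeq x) (t : ℤ) : ‖x t‖ = ‖x 0‖ := by
  have h := hx 0 0 t
  rw [zero_add, real_inner_self_eq_norm_sq, real_inner_self_eq_norm_sq] at h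
  exact (sq_eq_sq₀ (norm_nonneg _) (norm_nonneg _)).1 h

lemma mem_closedSpan {x : ℤ → E} {K : Set ℤ} {k : ℤ} (hk : k ∈ K) : x k ∈ closedSpan x K :=
  Submodule.le_topologicalClosure _ (Submodule.subset_span ⟨k, hk, rfl⟩)

lemma closedSpan_mono (x : ℤ → E) {K L : Set ℤ} (hKL : K ⊆ L) :
    closedSpan x K ≤ closedSpan x L :=
  Submodule.topologicalClosure_mono (Submodule.span_mono (Set.image_mono hKL))

lemma truncation_mem (x : ℤ → E) (g : ℕ → ℝ) (n : ℕ) :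
    ∑ k ∈ Finset.range n, g k • x ((n : ℤ) - k) ∈ closedSpan x (Set.Icc 1 (n : ℤ)) :=
  Submodule.sum_mem _ fun k hk => Submodule.smul_mem _ _ (mem_closedSpan (by
    rw [Finset.mem_range] at hk
    constructor <;> omega))

lemma inner_eq_zero_of_mem_closedSpan {x : ℤ → E} {K : Set ℤ} {u v : E}
    (hu : ∀ k ∈ K, inner ℝ u (x k) = 0) (hv : v ∈ closedSpan x K) : inner ℝ u v = 0 := by
  have hle : closedSpan x K ≤ (Submodule.span ℝ {u})ᗮ := by
    refine Submodule.topologicalClosure_minimal _ ?_ (Submodule.isClosed_orthogonal _)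
    rw [Submodule.span_le]
    rintro _ ⟨k, hk, rfl⟩
    exact Submodule.mem_orthogonal_singleton_iff_inner_right.2 (hu k hk)
  exact Submodule.mem_orthogonal_singleton_iff_inner_right.1 (hle hv)

variable [CompleteSpace E]

lemma bestPredictor_mem (x : ℤ → E) (K : Set ℤ) (y : E) :
    bestPredictor x K y ∈ closedSpan x K :=
  Submodule.starProjection_apply_mem _ _

lemma bestPredictor_eq_of_inner {x : ℤ → E} {K : Set ℤ} {u v : E} (hv : v ∈ closedSpan x K)
    (h : ∀ k ∈ K, inner ℝ (u - v) (x k) = 0) : bestPredictor x K u = v :=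
  Submodule.eq_starProjection_of_mem_of_inner_eq_zero hv
    fun _ hw => inner_eq_zero_of_mem_closedSpan h hw

lemma bestPredictor_of_mem {x : ℤ → E} {K : Set ℤ} {v : E} (hv : v ∈ closedSpan x K) :
    bestPredictor x K v = v :=
  bestPredictor_eq_of_inner hv (by simp)

lemma inner_sub_bestPredictor {x : ℤ → E} {K : Set ℤ} (y : E) {k : ℤ} (hk : k ∈ K) :
    inner ℝ (y - bestPredictor x K y) (x k) = 0 :=
  Submodule.starProjection_inner_eq_zero _ _ (mem_closedSpan hk)

lemma bestPredictor_bestPredictor {x : ℤ → E} {K L : Set ℤ} (hKL : K ⊆ L) (y : E) :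
    bestPredictor x K (bestPredictor x L y) = bestPredictor x K y := by
  refine bestPredictor_eq_of_inner (bestPredictor_mem _ _ _) fun k hk => ?_
  have h₁ := inner_sub_bestPredictor (x := x) y (hKL hk)
  have h₂ := inner_sub_bestPredictor (x := x) y hk
  rw [inner_sub_left] at *
  linarith

lemma bestPredictor_sub (x : ℤ → E) (K : Set ℤ) (u v : E) :
    bestPredictor x K (u - v) = bestPredictor x K u - bestPredictor x K v :=
  map_sub _ _ _

lemma norm_bestPredictor_le (x : ℤ → E) (K : Set ℤ) (y : E) : ‖bestPredictor x K y‖ ≤ ‖y‖ :=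
  Submodule.norm_starProjection_apply_le _ _

lemma innovation_mem (x : ℤ → E) {s t : ℤ} (hst : s ≤ t) :
    innovation x s ∈ closedSpan x (Set.Iic t) :=
  Submodule.sub_mem _ (mem_closedSpan hst)
    (closedSpan_mono x (fun _ hk => (le_of_lt hk).trans hst) (bestPredictor_mem _ _ _))

lemma inner_innovation_of_lt (x : ℤ → E) {s t : ℤ} (hst : t < s) :
    inner ℝ (innovation x s) (x t) = 0 :=
  inner_sub_bestPredictor _ hst

lemma inner_innovation_mem {x : ℤ → E} {s t : ℤ} (hst : t < s) {v : E}
    (hv : v ∈ closedSpan x (Set.Iic t)) : inner ℝ (innovation x s) v = 0 :=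
  inner_eq_zero_of_mem_closedSpan (fun _ hk => inner_innovation_of_lt x (lt_of_le_of_lt hk hst)) hv

lemma inner_innovation_innovation (x : ℤ → E) {s t : ℤ} (hst : s ≠ t) :
    inner ℝ (innovation x s) (innovation x t) = 0 := by
  rcases hst.lt_or_gt with h | h
  · rw [real_inner_comm]
    exact inner_innovation_mem h (innovation_mem x le_rfl)
  · exact inner_innovation_mem h (innovation_mem x le_rfl)

lemma bestPredictor_Iio_mem (x : ℤ → E) (t : ℤ) (y : E) :
    bestPredictor x (Set.Iio t) y ∈ closedSpan x (Set.Iic (t - 1)) :=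
  closedSpan_mono x (fun k (hk : k < t) => (by simp; omega)) (bestPredictor_mem _ _ _)

lemma inner_self_innovation (x : ℤ → E) (t : ℤ) :
    inner ℝ (x t) (innovation x t) = ‖innovation x t‖ ^ 2 := by
  have h := inner_innovation_mem (x := x) (sub_one_lt t) (bestPredictor_Iio_mem x t (x t))
  have hx : x t = innovation x t + bestPredictor x (Set.Iio t) (x t) := by simp [innovation]
  conv_lhs => rw [hx]
  rw [inner_add_left, real_inner_self_eq_norm_sq, real_inner_comm, h, add_zero]

/-- Adding the present to the past adds the projection onto the innovation. -/
lemma bestPredictor_Iic (x : ℤ → E) (t : ℤ) (y : E) :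
    bestPredictor x (Set.Iic t) y = bestPredictor x (Set.Iic (t - 1)) y +
      (inner ℝ y (innovation x t) / ‖innovation x t‖ ^ 2) • innovation x t := by
  set e := innovation x t with he
  set p := bestPredictor x (Set.Iic (t - 1)) y with hp
  have hpm : p ∈ closedSpan x (Set.Iic (t - 1)) := bestPredictor_mem _ _ _
  refine bestPredictor_eq_of_inner (Submodule.add_mem _ ?_ (Submodule.smul_mem _ _ ?_)) ?_
  · exact closedSpan_mono x (Set.Iic_subset_Iic.2 (by omega)) hpm
  · exact innovation_mem x le_rfl
  -- The residual is orthogonal to the strict past. Since `x t` is the innovation plus an element of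
  -- that past, only the pairing with `e` remains.
  have hlt : ∀ v ∈ closedSpan x (Set.Iic (t - 1)), inner ℝ
      (y - (p + (inner ℝ y e / ‖e‖ ^ 2) • e)) v = 0 := by
    intro v hv
    have h₁ : inner ℝ e v = 0 := inner_innovation_mem (by omega) hv
    have h₂ : inner ℝ (y - p) v = 0 := Submodule.starProjection_inner_eq_zero _ _ hv
    rw [← sub_sub, inner_sub_left, h₂, real_inner_smul_left, h₁]
    simp
  intro k hk
  rcases (show k ≤ t from hk).lt_or_eq with hk | rfl
  · exact hlt _ (mem_closedSpan (by simp; omega))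
  have hx : x k = e + bestPredictor x (Set.Iio k) (x k) := by simp [he, innovation]
  rw [hx, inner_add_right, hlt _ (bestPredictor_Iio_mem _ _ _), add_zero, ← sub_sub,
    inner_sub_left, inner_sub_left, real_inner_smul_left, real_inner_self_eq_norm_sq,
    real_inner_comm e p, inner_innovation_mem (sub_one_lt k) hpm]
  -- For `e = 0` the coefficient is `0` by division by zero, and the formula still holds.
  rcases eq_or_ne e 0 with h0 | h0
  · simp [h0]
  · have : ‖e‖ ^ 2 ≠ 0 := by simpa using h0
    field_simp
    ring

/-- Elements of a closed span can be shifted along with a stationary sequence. -/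
lemma IsStationarySeq.exists_shift {x : ℤ → E} (hx : IsStationarySeq x) {K L : Set ℤ} (r : ℤ)
    (hKL : ∀ k ∈ K, k + r ∈ L) {v : E} (hv : v ∈ closedSpan x K) :
    ∃ w ∈ closedSpan x L, ∀ s, inner ℝ (x (s + r)) w = inner ℝ (x s) v := by
  let T : (ℤ →₀ ℝ) →ₗ[ℝ] E := Finsupp.linearCombination ℝ x
  let S : (ℤ →₀ ℝ) →ₗ[ℝ] E := Finsupp.linearCombination ℝ fun k => x (k + r)
  have hTS : ∀ (s : ℤ) c, inner ℝ (x (s + r)) (S c) = inner ℝ (x s) (T c) := by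
    intro s c
    simp only [S, T, Finsupp.linearCombination_apply, Finsupp.sum, inner_sum, inner_smul_right,
      hx s]
  -- Shifting preserves the norms of finite combinations, so it carries Cauchy sequences to Cauchy
  -- sequences; this is how it reaches the closure.
  have hin : ∀ c, inner ℝ (S c) (S c) = inner ℝ (T c) (T c) := by
    intro c
    conv_lhs => enter [2]; rw [Finsupp.linearCombination_apply]
    conv_rhs => enter [2]; rw [Finsupp.linearCombination_apply]
    simp only [Finsupp.sum, sum_inner, inner_smul_left, hTS]
  have hnorm : ∀ c, ‖S c‖ = ‖T c‖ := by
    intro c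
    have := hin c
    rw [real_inner_self_eq_norm_sq, real_inner_self_eq_norm_sq] at this
    exact (sq_eq_sq₀ (norm_nonneg _) (norm_nonneg _)).1 this
  obtain ⟨v', hv', hlim⟩ := mem_closure_iff_seq_limit.1
    (show v ∈ closure (Submodule.span ℝ (x '' K) : Set E) from hv)
  have hc : ∀ n, ∃ c ∈ Finsupp.supported ℝ ℝ K, T c = v' n := fun n =>
    (Finsupp.mem_span_image_iff_linearCombination ℝ).1 (hv' n)
  choose c hcs hcv using hc
  have hcau : CauchySeq fun n => S (c n) := by
    have h := hlim.cauchySeq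
    rw [Metric.cauchySeq_iff'] at h ⊢
    intro ε hε
    obtain ⟨N, hN⟩ := h ε hε
    refine ⟨N, fun n hn => ?_⟩
    have := hN n hn
    rwa [dist_eq_norm, ← hcv, ← hcv, ← map_sub, ← hnorm, map_sub, ← dist_eq_norm] at this
  obtain ⟨w, hw⟩ := cauchySeq_tendsto_of_complete hcau
  refine ⟨w, ?_, fun s => ?_⟩
  · refine (Submodule.isClosed_topologicalClosure _).mem_of_tendsto hw (.of_forall fun n => ?_)
    simp only [S, Finsupp.linearCombination_apply, Finsupp.sum]
    refine Submodule.sum_mem _ fun k hk => Submodule.smul_mem _ _ (mem_closedSpan (hKL k ?_))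
    exact (Finsupp.mem_supported ℝ _).1 (hcs n) hk
  · refine tendsto_nhds_unique (tendsto_const_nhds.inner hw) ?_
    simp only [hTS, hcv]
    exact tendsto_const_nhds.inner hlim

variable {x : ℤ → E}

/-- The shifted predictor satisfies the normal equations at the shifted time, so prediction commutes
with shifts. -/
lemma IsStationarySeq.inner_innovation (hx : IsStationarySeq x) (s t r : ℤ) :
    inner ℝ (x (s + r)) (innovation x (t + r)) = inner ℝ (x s) (innovation x t) := by
  obtain ⟨w, hw, hwi⟩ := hx.exists_shift (K := Set.Iio t) (L := Set.Iio (t + r)) r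
    (by simp) (bestPredictor_mem x (Set.Iio t) (x t))
  have hpw : bestPredictor x (Set.Iio (t + r)) (x (t + r)) = w := by
    refine bestPredictor_eq_of_inner hw fun k hk => ?_
    have h₁ := hwi (k - r)
    have h₂ := hx (k - r) t r
    rw [sub_add_cancel] at h₁ h₂
    rw [real_inner_comm, inner_sub_right, h₁, h₂, ← inner_sub_right, real_inner_comm]
    exact inner_sub_bestPredictor _ (by simp at hk ⊢; omega)
  rw [innovation, hpw, inner_sub_right, hwi, hx, ← inner_sub_right, ← innovation]

lemma IsStationarySeq.norm_innovation (hx : IsStationarySeq x) (t : ℤ) :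
    ‖innovation x t‖ = ‖innovation x 0‖ := by
  have h := hx.inner_innovation 0 0 t
  rw [zero_add, inner_self_innovation, inner_self_innovation] at h
  exact (sq_eq_sq₀ (norm_nonneg _) (norm_nonneg _)).1 h

lemma IsStationarySeq.maCoeff_eq (hx : IsStationarySeq x) (t : ℤ) (j : ℕ) :
    inner ℝ (x t) (innovation x (t - j)) / ‖innovation x (t - j)‖ ^ 2 = maCoeff x j := by
  have h := hx.inner_innovation 0 (-(j : ℤ)) t
  rw [zero_add, neg_add_eq_sub] at h
  rw [maCoeff, h, hx.norm_innovation, hx.norm_innovation (-(j : ℤ))]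

/-- Each step into the past removes one innovation (`bestPredictor_Iic`), and by stationarity its
coefficient is `ψ_j` whatever the time `t`. -/
lemma IsStationarySeq.bestPredictor_sub_nat (hx : IsStationarySeq x) (t : ℤ) (N : ℕ) :
    bestPredictor x (Set.Iic (t - N)) (x t) =
      x t - ∑ j ∈ Finset.range N, maCoeff x j • innovation x (t - j) := by
  induction N with
  | zero => simp [bestPredictor_of_mem (mem_closedSpan (x := x) (Set.mem_Iic.2 le_rfl))]
  | succ N ih =>
    have h := bestPredictor_Iic x (t - N) (x t)
    rw [hx.maCoeff_eq, ih] at h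
    rw [Finset.sum_range_succ, ← sub_sub, h]
    push_cast
    rw [sub_sub t]
    abel

/-- The orthogonal complements of the pasts increase, and their union is dense because the remote
past is trivial; hence the projections onto them tend to the identity. -/
lemma IsPurelyNondeterministic.tendsto_bestPredictor (hx : IsPurelyNondeterministic x)
    (t : ℤ) (y : E) :
    Tendsto (fun N : ℕ => bestPredictor x (Set.Iic (t - N)) y) atTop (𝓝 0) := by
  let U : ℕ → Submodule ℝ E := fun N => (closedSpan x (Set.Iic (t - N)))ᗮ
  have hmono : Monotone U := fun M N hMN =>
    Submodule.orthogonal_le (closedSpan_mono x (Set.Iic_subset_Iic.2 (by omega)))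
  have hcl : ∀ N : ℕ, (U N)ᗮ = closedSpan x (Set.Iic (t - N)) := fun N => by
    simp only [U, Submodule.orthogonal_orthogonal]
  have htop : (⨆ N, U N).topologicalClosure = ⊤ := by
    rw [Submodule.topologicalClosure_eq_top_iff, ← Submodule.iInf_orthogonal, eq_bot_iff, ← hx]
    refine le_iInf fun n => ?_
    refine (iInf_le _ (t - n).toNat).trans ?_
    rw [hcl]
    exact closedSpan_mono x (Set.Iic_subset_Iic.2 (by omega))
  have h := Submodule.starProjection_tendsto_self U hmono y htop.ge
  have h' := (tendsto_const_nhds (x := y)).sub h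
  rw [sub_self] at h'
  refine h'.congr fun N => ?_
  simp only [U, Submodule.starProjection_orthogonal_val, sub_sub_cancel, bestPredictor]

/-- The Wold decomposition, as a limit of partial sums. -/
lemma IsStationarySeq.tendsto_wold (hx : IsStationarySeq x) (hnd : IsPurelyNondeterministic x)
    (t : ℤ) : Tendsto (fun N : ℕ => ∑ j ∈ Finset.range N, maCoeff x j • innovation x (t - j))
      atTop (𝓝 (x t)) := by
  have h := (tendsto_const_nhds (x := x t)).sub (hnd.tendsto_bestPredictor t (x t))
  rw [sub_zero] at h
  refine h.congr fun N => ?_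
  rw [hx.bestPredictor_sub_nat, sub_sub_cancel]

/-- All innovations have the same norm, so if one vanished the Wold series would give `x 0 = 0`. -/
lemma IsStationarySeq.innovation_ne_zero (hx : IsStationarySeq x)
    (hnd : IsPurelyNondeterministic x) (h0 : x 0 ≠ 0) (t : ℤ) : innovation x t ≠ 0 := by
  intro he
  have hall : ∀ s, innovation x s = 0 := fun s => by
    rw [← norm_eq_zero, hx.norm_innovation, ← hx.norm_innovation t, he, norm_zero]
  refine h0 (tendsto_nhds_unique (hx.tendsto_wold hnd 0) ?_)
  simp [hall]

end Geometry

/-! ### Absolutely summable filters and their composition. -/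

section Convolution

variable {E : Type*} [NormedAddCommGroup E] [NormedSpace ℝ E]

lemma summable_norm_smul_of_bounded {ι : Type*} {a : ι → ℝ} {v : ι → E} {C : ℝ}
    (ha : Summable fun i => |a i|) (hv : ∀ i, ‖v i‖ ≤ C) : Summable fun i => ‖a i • v i‖ :=
  (ha.mul_right C).of_nonneg_of_le (fun _ => norm_nonneg _) fun i => by
    rw [norm_smul, Real.norm_eq_abs]
    exact mul_le_mul_of_nonneg_left (hv i) (abs_nonneg _)

lemma norm_tsum_smul_le {ι : Type*} {a : ι → ℝ} {v : ι → E} {C : ℝ}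
    (ha : Summable fun i => |a i|) (hv : ∀ i, ‖v i‖ ≤ C) :
    ‖∑' i, a i • v i‖ ≤ (∑' i, |a i|) * C := by
  have h := summable_norm_smul_of_bounded ha hv
  refine (norm_tsum_le_tsum_norm h).trans ?_
  rw [← tsum_mul_right]
  refine h.tsum_le_tsum (fun i => ?_) (ha.mul_right C)
  rw [norm_smul, Real.norm_eq_abs]
  exact mul_le_mul_of_nonneg_left (hv i) (abs_nonneg _)

variable [CompleteSpace E]

lemma summable_smul_of_bounded {ι : Type*} {a : ι → ℝ} {v : ι → E} {C : ℝ}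
    (ha : Summable fun i => |a i|) (hv : ∀ i, ‖v i‖ ≤ C) : Summable fun i => a i • v i :=
  (summable_norm_smul_of_bounded ha hv).of_norm

lemma summable_abs_antidiagonal {a b : ℕ → ℝ} (ha : Summable fun i => |a i|)
    (hb : Summable fun i => |b i|) :
    Summable fun k => |∑ p ∈ Finset.HasAntidiagonal.antidiagonal k, a p.1 * b p.2| :=
  summable_norm_sum_mul_antidiagonal_of_summable_norm (f := a) (g := b) ha hb

/-- Applying two absolutely summable causal filters in turn amounts to applying their
convolution. -/
lemma tsum_smul_tsum_smul {a b : ℕ → ℝ} {v : ℕ → E} {C : ℝ} (ha : Summable fun i => |a i|)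
    (hb : Summable fun i => |b i|) (hv : ∀ i, ‖v i‖ ≤ C) :
    ∑' l, a l • ∑' j, b j • v (l + j) =
      ∑' k, (∑ p ∈ Finset.HasAntidiagonal.antidiagonal k, a p.1 * b p.2) • v k := by
  have hab : Summable fun p : ℕ × ℕ => |a p.1 * b p.2| := by
    simpa only [abs_mul] using ha.mul_of_nonneg hb (fun _ => abs_nonneg _) fun _ => abs_nonneg _
  have hF : Summable fun p : ℕ × ℕ => (a p.1 * b p.2) • v (p.1 + p.2) :=
    summable_smul_of_bounded hab fun p => hv (p.1 + p.2)
  have h₁ : ∑' p : ℕ × ℕ, (a p.1 * b p.2) • v (p.1 + p.2) =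
      ∑' l, a l • ∑' j, b j • v (l + j) := by
    rw [hF.tsum_prod]
    refine tsum_congr fun l => ?_
    rw [← (summable_smul_of_bounded hb fun j => hv (l + j)).tsum_const_smul]
    exact tsum_congr fun j => mul_smul _ _ _
  -- The double series is absolutely summable and may be regrouped along `l + j = k`.
  rw [← h₁, ← Finset.HasAntidiagonal.sigmaAntidiagonalEquivProd.tsum_eq]
  have hG := Finset.HasAntidiagonal.sigmaAntidiagonalEquivProd.summable_iff.2 hF
  refine hG.tsum_sigma.trans (tsum_congr fun k => ?_)
  rw [tsum_fintype, Finset.sum_smul, ← Finset.sum_coe_sort (Finset.HasAntidiagonal.antidiagonal k)]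
  refine Finset.sum_congr rfl fun p _ => ?_
  have hp : (p : ℕ × ℕ).1 + (p : ℕ × ℕ).2 = k := Finset.HasAntidiagonal.mem_antidiagonal.1 p.2
  simp [hp]

end Convolution

/-! ### AR representation, biorthogonal system and `ℓ²` bounds. -/

section Regular

variable {E : Type*} [NormedAddCommGroup E] [InnerProductSpace ℝ E] [CompleteSpace E]

/-- A nonzero purely nondeterministic stationary sequence with absolutely summable MA and AR
coefficients. -/
structure IsRegularSeq (x : ℤ → E) : Prop where
  stationary : IsStationarySeq x
  nondeterministic : IsPurelyNondeterministic x
  ne_zero : x 0 ≠ 0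
  summable_ma : Summable fun j : ℕ => |maCoeff x j|
  summable_ar : Summable fun j : ℕ => |arCoeff x j|

namespace IsRegularSeq

variable {x : ℤ → E} (hx : IsRegularSeq x)
include hx

lemma norm_le (t : ℤ) : ‖x t‖ ≤ ‖x 0‖ := (hx.stationary.norm_eq t).le

lemma norm_innovation_le (t : ℤ) : ‖innovation x t‖ ≤ ‖innovation x 0‖ :=
  (hx.stationary.norm_innovation t).le

lemma hasSum_wold (t : ℤ) :
    HasSum (fun j : ℕ => maCoeff x j • innovation x (t - j)) (x t) := by
  have hs : Summable fun j : ℕ => maCoeff x j • innovation x (t - j) :=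
    summable_smul_of_bounded hx.summable_ma fun j => hx.norm_innovation_le _
  have h := hs.hasSum
  rwa [tendsto_nhds_unique h.tendsto_sum_nat
    (hx.stationary.tendsto_wold hx.nondeterministic t)] at h

lemma norm_innovation_pos : 0 < ‖innovation x 0‖ :=
  norm_pos_iff.2 (hx.stationary.innovation_ne_zero hx.nondeterministic hx.ne_zero 0)

lemma maCoeff_zero : maCoeff x 0 = 1 := by
  have h := hx.norm_innovation_pos.ne'
  simp only [maCoeff, Nat.cast_zero, neg_zero, inner_self_innovation]
  exact div_self (pow_ne_zero 2 h)

lemma sum_arCoeff_mul_maCoeff (k : ℕ) :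
    ∑ p ∈ Finset.HasAntidiagonal.antidiagonal k, arCoeff x p.1 * maCoeff x p.2 =
      if k = 0 then -1 else 0 := by
  have h : (PowerSeries.mk (maCoeff x))⁻¹ * PowerSeries.mk (maCoeff x) = 1 := by
    refine PowerSeries.inv_mul_cancel _ ?_
    rw [← PowerSeries.coeff_zero_eq_constantCoeff_apply, PowerSeries.coeff_mk, hx.maCoeff_zero]
    exact one_ne_zero
  have hk := congrArg (PowerSeries.coeff k) h
  rw [PowerSeries.coeff_mul, PowerSeries.coeff_one] at hk
  simp only [PowerSeries.coeff_mk] at hk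
  simp only [arCoeff, neg_mul, Finset.sum_neg_distrib, hk]
  split_ifs <;> simp

/-- The AR(∞) representation of the innovations. -/
lemma innovation_eq_tsum (t : ℤ) :
    innovation x t = ∑' l : ℕ, (-arCoeff x l) • x (t - l) := by
  have h := tsum_smul_tsum_smul (v := fun k : ℕ => innovation x (t - k)) hx.summable_ar
    hx.summable_ma (fun k => hx.norm_innovation_le _)
  simp only [hx.sum_arCoeff_mul_maCoeff] at h
  rw [tsum_eq_single (f := fun k : ℕ => (if k = 0 then (-1 : ℝ) else 0) • innovation x (t - k)) 0
    (fun k hk => by simp [hk])] at h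
  simp only [if_true, Nat.cast_zero, sub_zero, neg_smul, one_smul, Nat.cast_add, ← sub_sub] at h
  simp only [fun s => (hx.hasSum_wold s).tsum_eq] at h
  rw [← neg_eq_iff_eq_neg.2 h]
  simp only [neg_smul, tsum_neg]

lemma inner_innovation_sub (s : ℤ) (j : ℕ) :
    inner ℝ (innovation x (s - j)) (x s) = ‖innovation x 0‖ ^ 2 * maCoeff x j := by
  have h := hx.norm_innovation_pos.ne'
  rw [real_inner_comm, ← hx.stationary.maCoeff_eq s j, hx.stationary.norm_innovation (s - j)]
  field_simp

/-- The sequence biorthogonal to `x`. -/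
lemma exists_dual : ∃ C : ℝ, 0 ≤ C ∧ ∀ t, ∃ d : E, ‖d‖ ≤ C ∧ inner ℝ d (x t) = 1 ∧
    ∀ s, s ≠ t → inner ℝ d (x s) = 0 := by
  set c := ‖innovation x 0‖ with hc
  have hcpos : 0 < c := hx.norm_innovation_pos
  refine ⟨(c ^ 2)⁻¹ * ((∑' l, |arCoeff x l|) * c), by positivity, fun t => ?_⟩
  -- Pairing `w` with `x_{t+m}` gives `c² ∑_{l≤m} φ_l ψ_{m-l}`, which is `-c²` for `m = 0` and `0`
  -- for `m > 0`; before `t` the innovations are orthogonal to `x`. So `-w / c²` is the dual vector.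
  let w := ∑' l : ℕ, arCoeff x l • innovation x (t + l)
  have hs : Summable fun l : ℕ => arCoeff x l • innovation x (t + l) :=
    summable_smul_of_bounded hx.summable_ar fun l => hx.norm_innovation_le _
  have hin : ∀ s, inner ℝ w (x s) =
      ∑' l : ℕ, arCoeff x l * inner ℝ (innovation x (t + l)) (x s) := by
    intro s
    rw [real_inner_comm]
    refine ((hs.hasSum.mapL (innerSL ℝ (x s))).tsum_eq.symm).trans (tsum_congr fun l => ?_)
    simp [real_inner_comm]
  have hlt : ∀ s, s < t → inner ℝ w (x s) = 0 := by
    intro s hst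
    rw [hin]
    refine (tsum_congr fun l => ?_).trans tsum_zero
    rw [inner_innovation_of_lt x (by omega), mul_zero]
  have hge : ∀ m : ℕ, inner ℝ w (x (t + m)) = c ^ 2 * if m = 0 then -1 else 0 := by
    intro m
    rw [hin, tsum_eq_sum (s := Finset.range (m + 1))]
    · rw [← hx.sum_arCoeff_mul_maCoeff,
        Finset.Nat.sum_antidiagonal_eq_sum_range_succ fun i j => arCoeff x i * maCoeff x j,
        Finset.mul_sum]
      refine Finset.sum_congr rfl fun l hl => ?_
      have h := hx.inner_innovation_sub (t + m) (m - l)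
      rw [Finset.mem_range] at hl
      rw [show t + (m : ℤ) - ((m - l : ℕ) : ℤ) = t + l by omega] at h
      rw [h]
      ring
    · intro l hl
      rw [Finset.mem_range] at hl
      rw [inner_innovation_of_lt x (by omega), mul_zero]
  refine ⟨-((c ^ 2)⁻¹ • w), ?_, ?_, fun s hst => ?_⟩
  · rw [norm_neg, norm_smul, norm_inv, norm_pow, Real.norm_of_nonneg hcpos.le]
    exact mul_le_mul_of_nonneg_left
      (norm_tsum_smul_le hx.summable_ar fun l => hx.norm_innovation_le _) (by positivity)
  · have h := hge 0
    simp only [Nat.cast_zero, add_zero, if_true] at h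
    rw [inner_neg_left, real_inner_smul_left, h]
    field_simp
  · rw [inner_neg_left, real_inner_smul_left]
    rcases hst.lt_or_gt with h | h
    · rw [hlt s h, mul_zero, neg_zero]
    · obtain ⟨m, rfl⟩ : ∃ m : ℕ, s = t + m := ⟨(s - t).toNat, by omega⟩
      rw [hge, if_neg (by omega)]
      simp

lemma norm_sum_innovation {ι : Type*} {f : ι → ℤ} (hf : f.Injective) (u : ι → ℝ)
    (F : Finset ι) : ‖∑ i ∈ F, u i • innovation x (f i)‖ =
      Real.sqrt (∑ i ∈ F, u i ^ 2) * ‖innovation x 0‖ := by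
  rw [← sq_eq_sq₀ (norm_nonneg _) (by positivity), mul_pow,
    Real.sq_sqrt (Finset.sum_nonneg fun _ _ => sq_nonneg _), ← real_inner_self_eq_norm_sq,
    sum_inner, Finset.sum_mul]
  refine Finset.sum_congr rfl fun i hi => ?_
  rw [inner_sum, Finset.sum_eq_single i]
  · rw [real_inner_smul_left, real_inner_smul_right, real_inner_self_eq_norm_sq,
      hx.stationary.norm_innovation]
    ring
  · intro j _ hji
    rw [real_inner_smul_left, real_inner_smul_right,
      inner_innovation_innovation x (hf.ne hji.symm)]
    simp
  · exact fun h => absurd hi h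

/-- Expanding each `x (f i)` by Wold and summing over `i` first leaves, for every lag `j`, `ψ_j`
times an orthogonal sum whose norm does not depend on `j`. This is the upper Riesz bound that lets
`ℓ²` filters act. -/
lemma norm_sum_le {ι : Type*} {f : ι → ℤ} (hf : f.Injective) (u : ι → ℝ) (F : Finset ι) :
    ‖∑ i ∈ F, u i • x (f i)‖ ≤
      (∑' j, |maCoeff x j|) * (Real.sqrt (∑ i ∈ F, u i ^ 2) * ‖innovation x 0‖) := by
  have h : HasSum (fun j : ℕ => ∑ i ∈ F, u i • maCoeff x j • innovation x (f i - j))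
      (∑ i ∈ F, u i • x (f i)) :=
    hasSum_sum fun i _ => (hx.hasSum_wold (f i)).const_smul (u i)
  have h' : ∀ j : ℕ, ∑ i ∈ F, u i • maCoeff x j • innovation x (f i - j) =
      maCoeff x j • ∑ i ∈ F, u i • innovation x (f i - j) := fun j => by
    rw [Finset.smul_sum]
    exact Finset.sum_congr rfl fun i _ => smul_comm _ _ _
  rw [← h.tsum_eq, tsum_congr h']
  exact norm_tsum_smul_le hx.summable_ma fun j =>
    (hx.norm_sum_innovation (f := fun i => f i - j)
      (fun a b hab => hf (sub_left_injective hab)) u F).le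

lemma summable_smul {ι : Type*} {f : ι → ℤ} (hf : f.Injective) {u : ι → ℝ}
    (hu : Summable fun i => u i ^ 2) : Summable fun i => u i • x (f i) := by
  -- The added `1` makes `D` evidently positive, so that `ε / D` makes sense.
  set D := (∑' j, |maCoeff x j|) * ‖innovation x 0‖ + 1 with hD
  have hDpos : 0 < D := by
    have : 0 ≤ (∑' j, |maCoeff x j|) * ‖innovation x 0‖ := by positivity
    linarith
  rw [summable_iff_vanishing_norm] at hu ⊢
  intro ε hε
  obtain ⟨s, hs⟩ := hu ((ε / D) ^ 2) (by positivity)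
  refine ⟨s, fun F hF => ?_⟩
  have h₀ : 0 ≤ ∑ i ∈ F, u i ^ 2 := Finset.sum_nonneg fun _ _ => sq_nonneg _
  have h₁ : Real.sqrt (∑ i ∈ F, u i ^ 2) < ε / D := by
    rw [Real.sqrt_lt' (by positivity)]
    exact (le_abs_self _).trans_lt (hs F hF)
  calc ‖∑ i ∈ F, u i • x (f i)‖
      ≤ (∑' j, |maCoeff x j|) * (Real.sqrt (∑ i ∈ F, u i ^ 2) * ‖innovation x 0‖) :=
        hx.norm_sum_le hf u F
    _ ≤ D * Real.sqrt (∑ i ∈ F, u i ^ 2) := by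
        rw [hD]
        nlinarith [Real.sqrt_nonneg (∑ i ∈ F, u i ^ 2)]
    _ < D * (ε / D) := mul_lt_mul_of_pos_left h₁ hDpos
    _ = ε := by field_simp

lemma norm_tsum_le {ι : Type*} {f : ι → ℤ} (hf : f.Injective) {u : ι → ℝ}
    (hu : Summable fun i => u i ^ 2) : ‖∑' i, u i • x (f i)‖ ≤
      (∑' j, |maCoeff x j|) * (Real.sqrt (∑' i, u i ^ 2) * ‖innovation x 0‖) := by
  refine le_of_tendsto (hx.summable_smul hf hu).hasSum.norm (.of_forall fun F => ?_)
  refine (hx.norm_sum_le hf u F).trans ?_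
  have := hu.sum_le_tsum F fun _ _ => sq_nonneg _
  gcongr

/-- The first `m + 1` Wold terms of `x_{n+m+1}` are innovations later than `n`, orthogonal to the
past; the remaining ones lie in the past. -/
lemma bestPredictor_ahead (n : ℤ) (m : ℕ) :
    bestPredictor x (Set.Iic n) (x (n + (m + 1))) =
      ∑' i : ℕ, maCoeff x (m + 1 + i) • innovation x (n - i) := by
  have hw := hx.hasSum_wold (n + (m + 1))
  have hsplit := hw.summable.sum_add_tsum_nat_add (m + 1)
  rw [hw.tsum_eq] at hsplit
  have he : ∀ i : ℕ, maCoeff x (i + (m + 1)) • innovation x (n + (m + 1) - ((i + (m + 1) : ℕ) : ℤ)) =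
      maCoeff x (m + 1 + i) • innovation x (n - i) := fun i => by
    rw [add_comm i]
    congr 2
    push_cast
    ring
  rw [tsum_congr he] at hsplit
  refine bestPredictor_eq_of_inner ?_ fun k hk => ?_
  · refine (Submodule.isClosed_topologicalClosure _).mem_of_tendsto
      (((summable_nat_add_iff (m + 1)).2 hw.summable).congr he).hasSum
      (.of_forall fun F => Submodule.sum_mem _ fun i _ => Submodule.smul_mem _ _ ?_)
    exact innovation_mem x (by omega)
  · rw [← hsplit, add_sub_cancel_right, sum_inner]
    refine Finset.sum_eq_zero fun j hj => ?_
    rw [Finset.mem_range] at hj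
    rw [real_inner_smul_left, inner_innovation_of_lt x (by simp at hk; omega), mul_zero]

end IsRegularSeq

end Regular

/-! ### Weighted summability and decay of tails. -/

section Rates

/-- An upper bound becomes an exact decomposition by taking `min (s n) (B n)` as the `O`-part: the
rest is nonnegative and at most `A n`. -/
lemma isLittleOAddBigO_of_le {s u v A B : ℕ → ℝ} (hs : ∀ n, 0 ≤ s n) (hB : ∀ n, 0 ≤ B n)
    (h : ∀ n, 1 ≤ n → s n ≤ A n + B n) (hAu : A =o[atTop] u) (hBv : B =O[atTop] v) :
    IsLittleOAddBigO s u v := by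
  refine ⟨fun n => s n - min (s n) (B n), fun n => min (s n) (B n), ?_, ?_, fun n => by ring⟩
  · refine IsBigO.trans_isLittleO (IsBigO.of_bound 1 ?_) hAu
    filter_upwards [eventually_ge_atTop 1] with n hn
    rw [one_mul, Real.norm_of_nonneg (sub_nonneg.2 (min_le_left _ _))]
    rcases le_total (s n) (B n) with h' | h'
    · rw [min_eq_left h', sub_self]
      exact norm_nonneg _
    · rw [min_eq_right h']
      exact le_trans (by linarith [h n hn]) (Real.le_norm_self _)
  · refine IsBigO.trans (IsBigO.of_bound 1 (.of_forall fun n => ?_)) hBv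
    rw [one_mul, Real.norm_of_nonneg (le_min (hs n) (hB n)), Real.norm_of_nonneg (hB n)]
    exact min_le_right _ _

lemma one_le_weight {β : ℝ} (hβ : 0 ≤ β) (k : ℕ) : 1 ≤ (1 + (k : ℝ)) ^ β :=
  Real.one_le_rpow (by simp) hβ

lemma weight_nonneg (β : ℝ) (k : ℕ) : 0 ≤ (1 + (k : ℝ)) ^ β := by positivity

/-- Submultiplicativity of the weight, which makes the weighted `ℓ¹` space closed under convolution.
-/
lemma weight_add_le {β : ℝ} (hβ : 0 ≤ β) (i l : ℕ) :
    (1 + ((i + l : ℕ) : ℝ)) ^ β ≤ (1 + (i : ℝ)) ^ β * (1 + (l : ℝ)) ^ β := by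
  rw [← Real.mul_rpow (by positivity) (by positivity)]
  refine Real.rpow_le_rpow (by positivity) ?_ hβ
  push_cast
  nlinarith [mul_nonneg (Nat.cast_nonneg (α := ℝ) i) (Nat.cast_nonneg (α := ℝ) l)]

lemma summable_of_weight {β : ℝ} (hβ : 0 ≤ β) {a : ℕ → ℝ}
    (ha : Summable fun k : ℕ => (1 + (k : ℝ)) ^ β * |a k|) : Summable fun k => |a k| :=
  ha.of_nonneg_of_le (fun _ => abs_nonneg _) fun k =>
    le_mul_of_one_le_left (abs_nonneg _) (one_le_weight hβ k)

/-- Weighted absolute summability is preserved by convolution. -/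
lemma summable_weight_antidiagonal {β : ℝ} (hβ : 0 ≤ β) {a b : ℕ → ℝ}
    (ha : Summable fun k : ℕ => (1 + (k : ℝ)) ^ β * |a k|)
    (hb : Summable fun k : ℕ => (1 + (k : ℝ)) ^ β * |b k|) :
    Summable fun k : ℕ => (1 + (k : ℝ)) ^ β *
      |∑ p ∈ Finset.HasAntidiagonal.antidiagonal k, a p.1 * b p.2| := by
  have habs : ∀ c : ℕ → ℝ, ∀ k : ℕ,
      abs ((1 + (k : ℝ)) ^ β * |c k|) = (1 + (k : ℝ)) ^ β * |c k| := fun c k =>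
    abs_of_nonneg (mul_nonneg (weight_nonneg β k) (abs_nonneg _))
  have h := summable_abs_antidiagonal (ha.congr fun k => (habs a k).symm)
    (hb.congr fun k => (habs b k).symm)
  refine h.of_nonneg_of_le (fun k => mul_nonneg (weight_nonneg β k) (abs_nonneg _)) fun k => ?_
  refine le_trans ?_ (le_abs_self _)
  refine (mul_le_mul_of_nonneg_left (Finset.abs_sum_le_sum_abs _ _) (weight_nonneg β k)).trans ?_
  rw [Finset.mul_sum]
  refine Finset.sum_le_sum fun p hp => ?_
  rw [← Finset.HasAntidiagonal.mem_antidiagonal.1 hp, abs_mul]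
  calc (1 + ((p.1 + p.2 : ℕ) : ℝ)) ^ β * (|a p.1| * |b p.2|)
      ≤ ((1 + (p.1 : ℝ)) ^ β * (1 + (p.2 : ℝ)) ^ β) * (|a p.1| * |b p.2|) :=
        mul_le_mul_of_nonneg_right (weight_add_le hβ _ _) (by positivity)
    _ = _ := by ring

/-- On the tail `n^β` is at most the weight, so `n^β` times the tail is dominated by the tail of a
convergent series. -/
lemma tsum_tail_isLittleO {β : ℝ} (hβ : 0 ≤ β) {a : ℕ → ℝ}
    (ha : Summable fun k : ℕ => (1 + (k : ℝ)) ^ β * |a k|) :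
    (fun n : ℕ => ∑' k : ℕ, |a (n + k)|) =o[atTop] fun n : ℕ => (n : ℝ) ^ (-β) := by
  have h := tendsto_sum_nat_add fun k : ℕ => (1 + (k : ℝ)) ^ β * |a k|
  have hne : ∀ᶠ n : ℕ in atTop, (n : ℝ) ^ (-β) = 0 → ∑' k : ℕ, |a (n + k)| = 0 := by
    filter_upwards [eventually_ge_atTop 1] with n hn h0
    have : (0 : ℝ) < n := by exact_mod_cast hn
    exact absurd h0 (Real.rpow_pos_of_pos this _).ne'
  rw [isLittleO_iff_tendsto' hne]
  refine squeeze_zero' (.of_forall fun n => by positivity) ?_ h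
  filter_upwards [eventually_ge_atTop 1] with n hn
  have hn' : (0 : ℝ) < n := by exact_mod_cast hn
  rw [Real.rpow_neg hn'.le, div_inv_eq_mul, ← tsum_mul_right]
  have hs := summable_of_weight hβ ha
  refine Summable.tsum_le_tsum (fun k => ?_) ?_ ((summable_nat_add_iff n).2 ha)
  · rw [mul_comm, add_comm n k]
    refine mul_le_mul_of_nonneg_right (Real.rpow_le_rpow hn'.le ?_ hβ) (abs_nonneg _)
    push_cast
    linarith [Nat.cast_nonneg (α := ℝ) k]
  · refine Summable.mul_right _ (((summable_nat_add_iff n).2 hs).congr fun k => ?_)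
    rw [add_comm]

/-- A two-fold tail sum costs one power of the weight. -/
lemma summable_weight_prod {α : ℝ} (hα : 1 ≤ α) {f : ℕ → ℝ}
    (hf : Summable fun k : ℕ => (1 + (k : ℝ)) ^ α * |f k|) :
    Summable fun p : ℕ × ℕ => (1 + (p.2 : ℝ)) ^ (α - 1) * |f (p.1 + 1 + p.2)| := by
  have h0 : ∀ p : ℕ × ℕ, 0 ≤ (1 + (p.2 : ℝ)) ^ (α - 1) * |f (p.1 + 1 + p.2)| := fun p =>
    mul_nonneg (weight_nonneg _ _) (abs_nonneg _)
  rw [← Finset.HasAntidiagonal.sigmaAntidiagonalEquivProd.summable_iff]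
  refine (summable_sigma_of_nonneg fun q => h0 _).2 ⟨fun n => Summable.of_finite, ?_⟩
  refine ((summable_nat_add_iff 1).2 hf).of_nonneg_of_le
    (fun n => tsum_nonneg fun q => h0 _) fun n => ?_
  -- The `n + 1` pairs with sum `n` contribute at most `(1+n)^(α-1) |f (n+1)|` each; their number
  -- supplies the missing power.
  rw [tsum_fintype]
  have hle : ∀ q : Finset.HasAntidiagonal.antidiagonal n,
      (1 + ((q : ℕ × ℕ).2 : ℝ)) ^ (α - 1) * |f ((q : ℕ × ℕ).1 + 1 + (q : ℕ × ℕ).2)| ≤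
        (1 + (n : ℝ)) ^ (α - 1) * |f (n + 1)| := by
    intro q
    have hq : (q : ℕ × ℕ).1 + (q : ℕ × ℕ).2 = n :=
      Finset.HasAntidiagonal.mem_antidiagonal.1 q.2
    rw [show (q : ℕ × ℕ).1 + 1 + (q : ℕ × ℕ).2 = n + 1 by omega]
    refine mul_le_mul_of_nonneg_right
      (Real.rpow_le_rpow (by positivity) ?_ (by linarith)) (abs_nonneg _)
    have : (q : ℕ × ℕ).2 ≤ n := by omega
    have : ((q : ℕ × ℕ).2 : ℝ) ≤ n := by exact_mod_cast this
    linarith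
  refine (Finset.sum_le_card_nsmul _ _ _ fun q _ => hle q).trans ?_
  rw [Finset.card_univ, Fintype.card_coe, Finset.Nat.card_antidiagonal, nsmul_eq_mul, ← mul_assoc]
  refine mul_le_mul_of_nonneg_right ?_ (abs_nonneg _)
  have hpos : (0 : ℝ) < 1 + n := by positivity
  have : ((n + 1 : ℕ) : ℝ) * (1 + (n : ℝ)) ^ (α - 1) = (1 + (n : ℝ)) ^ α := by
    rw [Real.rpow_sub_one hpos.ne']
    push_cast
    field_simp
    ring
  rw [this]
  refine Real.rpow_le_rpow hpos.le ?_ (by linarith)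
  push_cast
  linarith

end Rates

/-! ### The optimal causal filter and its truncation. -/

section Predictor

variable {E : Type*} [NormedAddCommGroup E] [InnerProductSpace ℝ E] [CompleteSpace E]

/-- The MA(∞) coefficients of the part of the predictor that is due to the future values. -/
def futureMA (x : ℤ → E) (h : ℤ → ℝ) (i : ℕ) : ℝ :=
  ∑' m : ℕ, h (-(m + 1 : ℤ)) * maCoeff x (m + 1 + i)

/-- The filter coefficients of the part of the predictor that is due to the future values. -/
def futureFilter (x : ℤ → E) (h : ℤ → ℝ) (k : ℕ) : ℝ :=
  ∑ p ∈ Finset.HasAntidiagonal.antidiagonal k, futureMA x h p.1 * -arCoeff x p.2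

/-- The weighted summability under which the future values have a summable predictor. -/
def SummableFuture (x : ℤ → E) (h : ℤ → ℝ) (β : ℝ) : Prop :=
  Summable fun p : ℕ × ℕ =>
    (1 + (p.2 : ℝ)) ^ β * (|h (-(p.1 + 1 : ℤ))| * |maCoeff x (p.1 + 1 + p.2)|)

variable {x : ℤ → E} {h : ℤ → ℝ} {β : ℝ}

lemma SummableFuture.abs (hβ : 0 ≤ β) (hf : SummableFuture x h β) :
    Summable fun p : ℕ × ℕ => |h (-(p.1 + 1 : ℤ)) * maCoeff x (p.1 + 1 + p.2)| :=
  Summable.of_nonneg_of_le (fun _ => abs_nonneg _) (fun p => by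
    rw [abs_mul]
    exact le_mul_of_one_le_left (by positivity) (one_le_weight hβ p.2)) hf

lemma SummableFuture.summable_futureMA (hβ : 0 ≤ β) (hf : SummableFuture x h β) :
    Summable fun i : ℕ => (1 + (i : ℝ)) ^ β * |futureMA x h i| := by
  have h₁ : Summable fun q : ℕ × ℕ =>
      (1 + (q.1 : ℝ)) ^ β * (|h (-(q.2 + 1 : ℤ))| * |maCoeff x (q.2 + 1 + q.1)|) := hf.prod_symm
  refine h₁.prod.of_nonneg_of_le
    (fun i => mul_nonneg (weight_nonneg _ _) (abs_nonneg _)) fun i => ?_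
  simp only [tsum_mul_left]
  refine mul_le_mul_of_nonneg_left ?_ (weight_nonneg _ _)
  have h₂ : Summable fun m : ℕ => ‖h (-(m + 1 : ℤ)) * maCoeff x (m + 1 + i)‖ :=
    (hf.abs hβ).prod_symm.prod_factor i
  refine (norm_tsum_le_tsum_norm h₂).trans_eq (tsum_congr fun m => ?_)
  rw [norm_mul, Real.norm_eq_abs, Real.norm_eq_abs]

lemma SummableFuture.summable_futureFilter (hβ : 0 ≤ β) (hf : SummableFuture x h β)
    (hφ : Summable fun j : ℕ => (1 + (j : ℝ)) ^ β * |arCoeff x j|) :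
    Summable fun k : ℕ => (1 + (k : ℝ)) ^ β * |futureFilter x h k| :=
  summable_weight_antidiagonal (b := fun l => -arCoeff x l) hβ (hf.summable_futureMA hβ)
    (by simpa only [abs_neg] using hφ)

/-- Projecting onto `V_{[1,n]}` may be done through `V_{(-∞,n]}`, and it fixes the truncated filter.
-/
lemma sigmaTilde_eq (x : ℤ → E) (h : ℤ → ℝ) (g : ℕ → ℝ) (n : ℕ) :
    sigmaTilde x h g n = ‖bestPredictor x (Set.Icc 1 (n : ℤ))
      (bestPredictor x (Set.Iic (n : ℤ)) (target x h n) -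
        ∑ k ∈ Finset.range n, g k • x ((n : ℤ) - k))‖ := by
  rw [bestPredictor_sub, bestPredictor_of_mem (truncation_mem x g n),
    bestPredictor_bestPredictor Set.Icc_subset_Iic_self, sigmaTilde]

/-- The truncated filter is one competitor in `V_{[1,n]}`, and the projection minimises the
distance. -/
lemma sigma_le (x : ℤ → E) (h : ℤ → ℝ) (g : ℕ → ℝ) (n : ℕ) :
    sigma x h n ≤ ‖bestPredictor x (Set.Iic (n : ℤ)) (target x h n) -
        ∑ k ∈ Finset.range n, g k • x ((n : ℤ) - k)‖ := by
  set y := bestPredictor x (Set.Iic (n : ℤ)) (target x h n) with hy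
  rw [sigma, ← bestPredictor_bestPredictor Set.Icc_subset_Iic_self (target x h n), ← hy,
    norm_sub_rev, bestPredictor, Submodule.starProjection_minimal]
  exact ciInf_le ⟨0, by rintro _ ⟨w, rfl⟩; exact norm_nonneg _⟩
    (⟨_, truncation_mem x g n⟩ : closedSpan x (Set.Icc 1 (n : ℤ)))

namespace IsRegularSeq

variable (hx : IsRegularSeq x)
include hx

lemma summable_target (hh : Summable fun k => h k ^ 2) (n : ℤ) :
    Summable fun k : ℤ => h k • x (n - k) :=
  hx.summable_smul (f := fun k => n - k) sub_right_injective hh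

/-- The future is predicted term by term, the sums over lead and lag are exchanged by absolute
summability, and each innovation is replaced by its AR series, which produces the convolution. -/
lemma bestPredictor_future (hh : Summable fun k => h k ^ 2) (hβ : 0 ≤ β)
    (hf : SummableFuture x h β) (n : ℤ) :
    bestPredictor x (Set.Iic n) (∑' m : ℕ, h (-(m + 1 : ℤ)) • x (n - -(m + 1 : ℤ))) =
      ∑' k : ℕ, futureFilter x h k • x (n - k) := by
  have hs : Summable fun m : ℕ => h (-(m + 1 : ℤ)) • x (n - -(m + 1 : ℤ)) :=
    (hx.summable_target hh n).comp_injective (i := fun m : ℕ => -(m + 1 : ℤ))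
      fun a b hab => by simpa using hab
  have h₁ : bestPredictor x (Set.Iic n) (∑' m : ℕ, h (-(m + 1 : ℤ)) • x (n - -(m + 1 : ℤ))) =
      ∑' m : ℕ, h (-(m + 1 : ℤ)) • bestPredictor x (Set.Iic n) (x (n - -(m + 1 : ℤ))) := by
    refine ((hs.hasSum.mapL (closedSpan x (Set.Iic n)).starProjection).tsum_eq.symm).trans
      (tsum_congr fun m => ?_)
    rw [map_smul, bestPredictor]
  have hF : Summable fun p : ℕ × ℕ =>
      (h (-(p.1 + 1 : ℤ)) * maCoeff x (p.1 + 1 + p.2)) • innovation x (n - p.2) :=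
    summable_smul_of_bounded (hf.abs hβ) fun p => hx.norm_innovation_le _
  have h₂ : ∀ m : ℕ, h (-(m + 1 : ℤ)) • bestPredictor x (Set.Iic n) (x (n - -(m + 1 : ℤ))) =
      ∑' i : ℕ, (h (-(m + 1 : ℤ)) * maCoeff x (m + 1 + i)) • innovation x (n - i) := by
    intro m
    have hsm : Summable fun i : ℕ => maCoeff x (m + 1 + i) • innovation x (n - i) := by
      refine summable_smul_of_bounded (((summable_nat_add_iff (m + 1)).2 hx.summable_ma).congr
        fun i => ?_) fun i => hx.norm_innovation_le _
      rw [add_comm]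
    rw [sub_neg_eq_add, hx.bestPredictor_ahead, ← hsm.tsum_const_smul]
    exact tsum_congr fun i => (mul_smul _ _ _).symm
  have h₃ : ∀ i : ℕ, ∑' m : ℕ, (h (-(m + 1 : ℤ)) * maCoeff x (m + 1 + i)) • innovation x (n - i) =
      futureMA x h i • ∑' l : ℕ, (-arCoeff x l) • x (n - ((i + l : ℕ) : ℤ)) := by
    intro i
    have hsi : Summable fun m : ℕ => h (-(m + 1 : ℤ)) * maCoeff x (m + 1 + i) :=
      ((hf.abs hβ).prod_symm.prod_factor i).of_abs
    rw [hsi.tsum_smul_const, ← futureMA, hx.innovation_eq_tsum]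
    simp only [Nat.cast_add, sub_sub]
  have h₄ := Summable.tsum_comm (f := fun m i : ℕ =>
    (h (-(m + 1 : ℤ)) * maCoeff x (m + 1 + i)) • innovation x (n - i)) hF
  rw [h₁, tsum_congr h₂, ← h₄, tsum_congr h₃]
  have hφ : Summable fun l : ℕ => |(-arCoeff x l)| := by
    simpa only [abs_neg] using hx.summable_ar
  exact tsum_smul_tsum_smul (a := futureMA x h) (b := fun l => -arCoeff x l)
    (v := fun k : ℕ => x (n - k)) (summable_of_weight hβ (hf.summable_futureMA hβ)) hφ
    fun k => hx.norm_le _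

lemma summable_filter (hh : Summable fun k => h k ^ 2) (n m : ℤ) :
    Summable fun k : ℕ => h (m + k) • x (n - k) :=
  hx.summable_smul (ι := ℕ) (f := fun k => n - k) (fun a b hab => by simpa using hab)
    (hh.comp_injective (i := fun k : ℕ => m + k) fun a b hab => by simpa using hab)

/-- The infinite-past predictor as a causal filter. -/
lemma hasSum_bestPredictor_target (hh : Summable fun k => h k ^ 2) (hβ : 0 ≤ β)
    (hf : SummableFuture x h β)
    (hφ : Summable fun j : ℕ => (1 + (j : ℝ)) ^ β * |arCoeff x j|) (n : ℤ) :
    HasSum (fun k : ℕ => (h k + futureFilter x h k) • x (n - k))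
      (bestPredictor x (Set.Iic n) (target x h n)) := by
  have hs := hx.summable_target hh n
  have hpast : Summable fun k : ℕ => h k • x (n - k) := by
    simpa using hx.summable_filter hh n 0
  have hfut : Summable fun m : ℕ => h (-(m + 1 : ℤ)) • x (n - -(m + 1 : ℤ)) :=
    hs.comp_injective (i := fun m : ℕ => -(m + 1 : ℤ)) fun a b hab => by simpa using hab
  have htar : target x h n = ∑' k : ℕ, h k • x (n - k) +
      ∑' m : ℕ, h (-(m + 1 : ℤ)) • x (n - -(m + 1 : ℤ)) :=
    (HasSum.of_nat_of_neg_add_one (f := fun k : ℤ => h k • x (n - k))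
      hpast.hasSum hfut.hasSum).tsum_eq
  have hmem : ∑' k : ℕ, h k • x (n - k) ∈ closedSpan x (Set.Iic n) :=
    (Submodule.isClosed_topologicalClosure _).mem_of_tendsto hpast.hasSum
      (.of_forall fun F => Submodule.sum_mem _ fun k _ =>
        Submodule.smul_mem _ _ (mem_closedSpan (by simp)))
  have hpred : bestPredictor x (Set.Iic n) (target x h n) =
      ∑' k : ℕ, h k • x (n - k) + ∑' k : ℕ, futureFilter x h k • x (n - k) := by
    rw [← hx.bestPredictor_future hh hβ hf n, htar]
    conv_rhs => rw [← bestPredictor_of_mem hmem]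
    exact map_add _ _ _
  have ha : Summable fun k : ℕ => futureFilter x h k • x (n - k) :=
    summable_smul_of_bounded (summable_of_weight hβ (hf.summable_futureFilter hβ hφ))
      fun k => hx.norm_le _
  rw [hpred]
  simpa only [add_smul] using hpast.hasSum.add ha.hasSum

lemma eq_of_tendsto {g g' : ℕ → ℝ} {n : ℤ} {y : E}
    (hg : Tendsto (fun N : ℕ => ∑ j ∈ Finset.range N, g j • x (n - j)) atTop (𝓝 y))
    (hg' : Tendsto (fun N : ℕ => ∑ j ∈ Finset.range N, g' j • x (n - j)) atTop (𝓝 y)) :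
    g = g' := by
  obtain ⟨C, -, hC⟩ := hx.exists_dual
  have key : ∀ u : ℕ → ℝ,
      Tendsto (fun N : ℕ => ∑ j ∈ Finset.range N, u j • x (n - j)) atTop (𝓝 y) →
      ∀ i : ℕ, ∀ d : E, inner ℝ d (x (n - i)) = 1 →
      (∀ s, s ≠ n - i → inner ℝ d (x s) = 0) → u i = inner ℝ d y := by
    intro u hu i d hd₁ hd₀
    refine tendsto_nhds_unique (tendsto_const_nhds.congr' ?_) ((tendsto_const_nhds (x := d)).inner hu)
    -- Once the partial sum contains index `i`, its pairing with the dual vector is constantly `u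
    -- i`.
    filter_upwards [eventually_ge_atTop (i + 1)] with N hN
    rw [inner_sum, Finset.sum_eq_single i]
    · rw [real_inner_smul_right, hd₁, mul_one]
    · intro j _ hji
      rw [real_inner_smul_right, hd₀ _ (by omega), mul_zero]
    · intro hi
      exact absurd (Finset.mem_range.2 (by omega)) hi
  funext i
  obtain ⟨d, -, hd₁, hd₀⟩ := hC (n - i)
  rw [key g hg i d hd₁ hd₀, key g' hg' i d hd₁ hd₀]

lemma existsUnique_filter (hh : Summable fun k => h k ^ 2) (hβ : 0 ≤ β)
    (hf : SummableFuture x h β)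
    (hφ : Summable fun j : ℕ => (1 + (j : ℝ)) ^ β * |arCoeff x j|) :
    IsOptimalCausalFilter x h (fun k => h k + futureFilter x h k) ∧
      ∀ g, IsOptimalCausalFilter x h g → g = fun k : ℕ => h k + futureFilter x h k := by
  have hopt : IsOptimalCausalFilter x h (fun k => h k + futureFilter x h k) := fun n _ =>
    (hx.hasSum_bestPredictor_target hh hβ hf hφ n).tendsto_sum_nat
  exact ⟨hopt, fun g hg => hx.eq_of_tendsto (hg 1 le_rfl) (hopt 1 le_rfl)⟩

/-- The error of the truncated infinite-past predictor. -/
lemma bestPredictor_sub_truncation (hh : Summable fun k => h k ^ 2) (hβ : 0 ≤ β)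
    (hf : SummableFuture x h β)
    (hφ : Summable fun j : ℕ => (1 + (j : ℝ)) ^ β * |arCoeff x j|) (n : ℕ) :
    bestPredictor x (Set.Iic (n : ℤ)) (target x h n) -
        ∑ k ∈ Finset.range n, (h k + futureFilter x h k) • x ((n : ℤ) - k) =
      ∑' k : ℕ, h ((n : ℤ) + k) • x (0 - k) +
        ∑' k : ℕ, futureFilter x h (n + k) • x (0 - k) := by
  have hs := hx.hasSum_bestPredictor_target hh hβ hf hφ n
  have h₁ := hx.summable_filter hh 0 n
  have h₂ : Summable fun k : ℕ => futureFilter x h (n + k) • x (0 - k) := by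
    refine summable_smul_of_bounded (((summable_nat_add_iff n).2
      (summable_of_weight hβ (hf.summable_futureFilter hβ hφ))).congr fun k => ?_)
      fun k => hx.norm_le _
    rw [add_comm]
  rw [← hs.tsum_eq, ← hs.summable.sum_add_tsum_nat_add n, add_sub_cancel_left, ← h₁.tsum_add h₂]
  refine tsum_congr fun k => ?_
  rw [← add_smul, add_comm k n]
  push_cast
  rw [show (n : ℤ) - (n + k) = 0 - k by ring]

lemma norm_tsum_futureFilter_le (hβ : 0 ≤ β) (hf : SummableFuture x h β)
    (hφ : Summable fun j : ℕ => (1 + (j : ℝ)) ^ β * |arCoeff x j|) (n : ℕ) :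
    ‖∑' k : ℕ, futureFilter x h (n + k) • x (0 - k)‖ ≤
      (∑' k : ℕ, |futureFilter x h (n + k)|) * ‖x 0‖ := by
  refine norm_tsum_smul_le (((summable_nat_add_iff n).2
    (summable_of_weight hβ (hf.summable_futureFilter hβ hφ))).congr fun k => ?_)
    fun k => hx.norm_le _
  rw [add_comm]

/-- The coefficients of a predictor from finitely many values are bounded by its norm; hence a
vector of the past that correlates summably with the future has a small projection. -/
lemma exists_norm_bestPredictor_Icc_le
    (hψ : Summable fun j : ℕ => (1 + (j : ℝ)) ^ (1 : ℝ) * |maCoeff x j|) :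
    ∃ C : ℝ, 0 ≤ C ∧ ∀ (u : ℕ → ℝ) (M : ℝ), (Summable fun k => u k ^ 2) → (∀ k, |u k| ≤ M) →
      ∀ n : ℤ, ‖bestPredictor x (Set.Icc 1 n) (∑' k : ℕ, u k • x (0 - k))‖ ≤ C * M := by
  obtain ⟨C, hC0, hC⟩ := hx.exists_dual
  set σ := ‖innovation x 0‖ with hσ
  set A := ∑' j, |maCoeff x j| with hA
  have hA0 : 0 ≤ A := tsum_nonneg fun _ => abs_nonneg _
  have hprod : Summable fun p : ℕ × ℕ => |maCoeff x (p.1 + 1 + p.2)| := by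
    simpa using summable_weight_prod le_rfl hψ
  -- `D m` bounds the correlation of `x_{m+1}` with the past; `∑ D m` is a double tail of `ψ`,
  -- finite by the weight of exponent `1`.
  set D : ℕ → ℝ := fun m => ∑' i : ℕ, |maCoeff x (m + 1 + i)| with hD
  have hD0 : ∀ m, 0 ≤ D m := fun m => tsum_nonneg fun _ => abs_nonneg _
  have hDs : Summable D := hprod.prod
  refine ⟨C * (σ ^ 2 * A * ∑' m, D m), by positivity, fun u M hu hM n => ?_⟩
  have hM0 : 0 ≤ M := (abs_nonneg _).trans (hM 0)
  set z := ∑' k : ℕ, u k • x (0 - k) with hz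
  have hzs : Summable fun k : ℕ => u k • x (0 - k) :=
    hx.summable_smul (f := fun k : ℕ => (0 : ℤ) - k) (fun a b hab => by simpa using hab) hu
  have hzmem : z ∈ closedSpan x (Set.Iic 0) :=
    (Submodule.isClosed_topologicalClosure _).mem_of_tendsto hzs.hasSum
      (.of_forall fun F => Submodule.sum_mem _ fun k _ =>
        Submodule.smul_mem _ _ (mem_closedSpan (by simp)))
  -- Only the `x_{-k}` with `k ≤ i` correlate with `ε_{-i}`, through `ψ_{i-k}`; so the supremum of
  -- `u` and the `ℓ¹` norm of `ψ` suffice.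
  have hinn : ∀ i : ℕ, |inner ℝ (innovation x (0 - i)) z| ≤ σ ^ 2 * A * M := by
    intro i
    have h₁ : HasSum (fun k : ℕ => u k * inner ℝ (innovation x (0 - i)) (x (0 - k)))
        (inner ℝ (innovation x (0 - i)) z) := by
      simpa only [innerSL_apply_apply, real_inner_smul_right] using
        hzs.hasSum.mapL (innerSL ℝ (innovation x (0 - i)))
    rw [← h₁.tsum_eq, tsum_eq_sum (s := Finset.range (i + 1))]
    · calc |∑ k ∈ Finset.range (i + 1), u k * inner ℝ (innovation x (0 - i)) (x (0 - k))|
          ≤ ∑ k ∈ Finset.range (i + 1), M * (σ ^ 2 * |maCoeff x (i - k)|) := by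
            refine (Finset.abs_sum_le_sum_abs _ _).trans (Finset.sum_le_sum fun k hk => ?_)
            rw [Finset.mem_range] at hk
            have h := hx.inner_innovation_sub (0 - k) (i - k)
            rw [show (0 : ℤ) - k - ((i - k : ℕ) : ℤ) = 0 - i by omega] at h
            rw [h, abs_mul, abs_mul, abs_of_nonneg (sq_nonneg σ)]
            exact mul_le_mul_of_nonneg_right (hM k) (by positivity)
        _ = M * (σ ^ 2 * ∑ j ∈ Finset.range (i + 1), |maCoeff x j|) := by
            rw [← Finset.mul_sum, ← Finset.mul_sum, Finset.sum_flip fun j => |maCoeff x j|]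
        _ ≤ M * (σ ^ 2 * A) := by
            have := hx.summable_ma.sum_le_tsum (Finset.range (i + 1)) fun _ _ => abs_nonneg _
            gcongr
        _ = σ ^ 2 * A * M := by ring
    · intro k hk
      rw [Finset.mem_range] at hk
      rw [inner_innovation_of_lt x (by omega), mul_zero]
  have hcorr : ∀ m : ℕ, |inner ℝ (x (0 + (m + 1))) z| ≤ D m * (σ ^ 2 * A * M) := by
    intro m
    have h₁ : inner ℝ (x (0 + (m + 1))) z =
        inner ℝ (bestPredictor x (Set.Iic 0) (x (0 + (m + 1)))) z := by
      rw [← sub_eq_zero, ← inner_sub_left]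
      exact Submodule.starProjection_inner_eq_zero _ _ hzmem
    have hsm : Summable fun i : ℕ => |maCoeff x (m + 1 + i)| := hprod.prod_factor m
    have hse : Summable fun i : ℕ => maCoeff x (m + 1 + i) • innovation x (0 - i) :=
      summable_smul_of_bounded hsm fun i => hx.norm_innovation_le _
    have h₂ := (hse.hasSum.mapL (innerSL ℝ z)).tsum_eq
    simp only [innerSL_apply_apply, real_inner_smul_right] at h₂
    rw [h₁, hx.bestPredictor_ahead, real_inner_comm, ← h₂]
    refine norm_tsum_smul_le (v := fun i : ℕ => inner ℝ z (innovation x (0 - i))) hsm fun i => ?_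
    rw [real_inner_comm]
    exact hinn i
  set p := bestPredictor x (Set.Icc 1 n) z with hp
  have hfin : FiniteDimensional ℝ (Submodule.span ℝ (x '' Set.Icc 1 n)) :=
    FiniteDimensional.span_of_finite ℝ ((Set.finite_Icc 1 n).image x)
  have hpmem : p ∈ Submodule.span ℝ (x '' Set.Icc 1 n) := by
    have := bestPredictor_mem x (Set.Icc 1 n) z
    rwa [closedSpan,
      (Submodule.closed_of_finiteDimensional _).submodule_topologicalClosure_eq] at this
  obtain ⟨c, hcs, hcp⟩ := (Finsupp.mem_span_image_iff_linearCombination ℝ).1 hpmem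
  rw [Finsupp.linearCombination_apply, Finsupp.sum] at hcp
  -- The dual vector at `k` reads off the coefficient `c k`, uniformly in `n`.
  have hcle : ∀ k ∈ c.support, |c k| ≤ C * ‖p‖ := by
    intro k hk
    obtain ⟨d, hdC, hd₁, hd₀⟩ := hC k
    have : inner ℝ d p = c k := by
      rw [← hcp, inner_sum, Finset.sum_eq_single k]
      · rw [real_inner_smul_right, hd₁, mul_one]
      · intro j _ hjk
        rw [real_inner_smul_right, hd₀ j hjk, mul_zero]
      · exact fun h => absurd hk h
    rw [← this]
    exact (abs_real_inner_le_norm d p).trans (mul_le_mul_of_nonneg_right hdC (norm_nonneg _))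
  have hsupp : ∀ k ∈ c.support, 1 ≤ k := fun k hk => ((Finsupp.mem_supported ℝ c).1 hcs hk).1
  have hsum : ∑ k ∈ c.support, D (k - 1).toNat ≤ ∑' m, D m := by
    rw [← Finset.sum_image (f := D) (g := fun k : ℤ => (k - 1).toNat)]
    · exact hDs.sum_le_tsum _ fun m _ => hD0 m
    · intro a ha b hb hab
      have h₁ := hsupp a ha
      have h₂ := hsupp b hb
      simp only at hab
      omega
  -- `‖p‖² = ⟨p, z⟩ = ∑ c_k ⟨x_k, z⟩`, where each `c_k` is at most `C ‖p‖` and the correlations are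
  -- summable; one factor `‖p‖` then cancels.
  have hsq : ‖p‖ * ‖p‖ ≤ C * (σ ^ 2 * A * ∑' m, D m) * M * ‖p‖ := by
    have hpz : inner ℝ p z = ‖p‖ * ‖p‖ := by
      rw [← real_inner_self_eq_norm_mul_norm, ← sub_eq_zero, ← inner_sub_right, real_inner_comm]
      exact Submodule.starProjection_inner_eq_zero _ _ (bestPredictor_mem _ _ _)
    calc ‖p‖ * ‖p‖ = ∑ k ∈ c.support, c k * inner ℝ (x k) z := by
          rw [← hpz]
          conv_lhs => rw [← hcp]
          rw [sum_inner]
          exact Finset.sum_congr rfl fun k _ => real_inner_smul_left _ _ _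
      _ ≤ ∑ k ∈ c.support, C * ‖p‖ * (D (k - 1).toNat * (σ ^ 2 * A * M)) := by
          refine Finset.sum_le_sum fun k hk => (le_abs_self _).trans ?_
          rw [abs_mul]
          have h₁ := hcorr (k - 1).toNat
          rw [show (0 : ℤ) + (((k - 1).toNat : ℤ) + 1) = k by have := hsupp k hk; omega] at h₁
          exact mul_le_mul (hcle k hk) h₁ (abs_nonneg _) (by positivity)
      _ = C * ‖p‖ * (σ ^ 2 * A * M) * ∑ k ∈ c.support, D (k - 1).toNat := by
          rw [Finset.mul_sum]
          exact Finset.sum_congr rfl fun k _ => by ring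
      _ ≤ C * ‖p‖ * (σ ^ 2 * A * M) * ∑' m, D m := by gcongr
      _ = _ := by ring
  rcases (norm_nonneg p).eq_or_lt with h0 | h0
  · rw [← h0]
    have : 0 ≤ ∑' m, D m := tsum_nonneg hD0
    positivity
  · exact le_of_mul_le_mul_right hsq h0

end IsRegularSeq

end Predictor

/-! ### The two sets of rates. -/

section Main

variable {E : Type*} [NormedAddCommGroup E] [InnerProductSpace ℝ E] [CompleteSpace E]
  {x : ℤ → E} {h : ℤ → ℝ} {α β : ℝ}

lemma summable_sq_of_summable_abs (hh : Summable fun k : ℤ => |h k|) :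
    Summable fun k => h k ^ 2 := by
  refine (hh.mul_left (∑' k, |h k|)).of_nonneg_of_le (fun _ => sq_nonneg _) fun k => ?_
  rw [← sq_abs, sq]
  exact mul_le_mul_of_nonneg_right (hh.le_tsum k fun _ _ => abs_nonneg _) (abs_nonneg _)

lemma abs_le_of_summable_sq (hh : Summable fun k => h k ^ 2) (k : ℤ) :
    |h k| ≤ Real.sqrt (∑' k, h k ^ 2) :=
  Real.abs_le_sqrt (hh.le_tsum k fun _ _ => sq_nonneg _)

/-- Raising the weight from `i` to `i + m + 1` bounds each sum over `i` by the full weighted norm of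
`ψ`, leaving `∑ |h|`. -/
lemma summableFuture_of_summable_abs (hα : 0 ≤ α) (hh : Summable fun k : ℤ => |h k|)
    (hψ : Summable fun j : ℕ => (1 + (j : ℝ)) ^ α * |maCoeff x j|) : SummableFuture x h α := by
  have h0 : ∀ p : ℕ × ℕ,
      0 ≤ (1 + (p.2 : ℝ)) ^ α * (|h (-(p.1 + 1 : ℤ))| * |maCoeff x (p.1 + 1 + p.2)|) := fun p =>
    mul_nonneg (weight_nonneg _ _) (by positivity)
  have hle : ∀ m i : ℕ, (1 + (i : ℝ)) ^ α * (|h (-(m + 1 : ℤ))| * |maCoeff x (m + 1 + i)|) ≤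
      |h (-(m + 1 : ℤ))| *
        ((1 + ((i + (m + 1) : ℕ) : ℝ)) ^ α * |maCoeff x (i + (m + 1))|) := by
    intro m i
    rw [add_comm (m + 1) i, mul_left_comm]
    refine mul_le_mul_of_nonneg_left (mul_le_mul_of_nonneg_right
      (Real.rpow_le_rpow (by positivity) ?_ hα) (abs_nonneg _)) (abs_nonneg _)
    push_cast
    linarith [Nat.cast_nonneg (α := ℝ) m]
  have htail : ∀ m : ℕ, Summable fun i : ℕ => |h (-(m + 1 : ℤ))| *
      ((1 + ((i + (m + 1) : ℕ) : ℝ)) ^ α * |maCoeff x (i + (m + 1))|) := fun m =>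
    ((summable_nat_add_iff (m + 1)).2 hψ).mul_left _
  have hsec : ∀ m : ℕ, Summable fun i : ℕ =>
      (1 + (i : ℝ)) ^ α * (|h (-(m + 1 : ℤ))| * |maCoeff x (m + 1 + i)|) := fun m =>
    (htail m).of_nonneg_of_le (fun i => h0 (m, i)) (hle m)
  refine (summable_prod_of_nonneg h0).2 ⟨hsec, ?_⟩
  have hh' : Summable fun m : ℕ => |h (-(m + 1 : ℤ))| :=
    hh.comp_injective (i := fun m : ℕ => -(m + 1 : ℤ)) fun a b hab => by simpa using hab
  refine (hh'.mul_right (∑' j : ℕ, (1 + (j : ℝ)) ^ α * |maCoeff x j|)).of_nonneg_of_le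
    (fun m => tsum_nonneg fun i => h0 (m, i)) fun m => ?_
  refine ((hsec m).tsum_le_tsum (hle m) (htail m)).trans ?_
  rw [tsum_mul_left]
  refine mul_le_mul_of_nonneg_left ?_ (abs_nonneg _)
  rw [← hψ.sum_add_tsum_nat_add (m + 1)]
  exact le_add_of_nonneg_left (Finset.sum_nonneg fun j _ =>
    mul_nonneg (weight_nonneg _ _) (abs_nonneg _))

/-- Here `h` is only used as a bounded sequence, so the double tail of `ψ` must converge by itself;
this costs one power. -/
lemma summableFuture_of_summable_sq (hα : 1 ≤ α) (hh : Summable fun k => h k ^ 2)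
    (hψ : Summable fun j : ℕ => (1 + (j : ℝ)) ^ α * |maCoeff x j|) :
    SummableFuture x h (α - 1) := by
  refine ((summable_weight_prod hα hψ).mul_left (Real.sqrt (∑' k, h k ^ 2))).of_nonneg_of_le
    (fun p => mul_nonneg (weight_nonneg _ _) (by positivity)) fun p => ?_
  rw [mul_left_comm]
  exact mul_le_mul_of_nonneg_right (abs_le_of_summable_sq hh _)
    (mul_nonneg (weight_nonneg _ _) (abs_nonneg _))

lemma summable_weight_mono {γ : ℝ} (hβγ : β ≤ γ) {a : ℕ → ℝ}
    (ha : Summable fun k : ℕ => (1 + (k : ℝ)) ^ γ * |a k|) :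
    Summable fun k : ℕ => (1 + (k : ℝ)) ^ β * |a k| :=
  ha.of_nonneg_of_le (fun k => mul_nonneg (weight_nonneg _ _) (abs_nonneg _)) fun k =>
    mul_le_mul_of_nonneg_right (Real.rpow_le_rpow_of_exponent_le (by simp) hβγ) (abs_nonneg _)

lemma sigma_nonneg (x : ℤ → E) (h : ℤ → ℝ) (n : ℕ) : 0 ≤ sigma x h n := norm_nonneg _

lemma sigmaTilde_nonneg (x : ℤ → E) (h : ℤ → ℝ) (g : ℕ → ℝ) (n : ℕ) :
    0 ≤ sigmaTilde x h g n := norm_nonneg _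

lemma SummableFuture.futureFilter_isLittleO (hβ : 0 ≤ β) (hf : SummableFuture x h β)
    (hφ : Summable fun j : ℕ => (1 + (j : ℝ)) ^ β * |arCoeff x j|) :
    (fun n : ℕ => (∑' k : ℕ, |futureFilter x h (n + k)|) * ‖x 0‖) =o[atTop]
      fun n : ℕ => (n : ℝ) ^ (-β) := by
  have h₁ := (tsum_tail_isLittleO hβ (hf.summable_futureFilter hβ hφ)).const_mul_left ‖x 0‖
  exact h₁.congr_left fun n => mul_comm _ _

namespace IsRegularSeq

variable (hx : IsRegularSeq x)
include hx

lemma norm_truncation_error_le (hh : Summable fun k => h k ^ 2) (hβ : 0 ≤ β)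
    (hf : SummableFuture x h β)
    (hφ : Summable fun j : ℕ => (1 + (j : ℝ)) ^ β * |arCoeff x j|) (n : ℕ) :
    ‖bestPredictor x (Set.Iic (n : ℤ)) (target x h n) -
        ∑ k ∈ Finset.range n, (h k + futureFilter x h k) • x ((n : ℤ) - k)‖ ≤
      (∑' k : ℕ, |futureFilter x h (n + k)|) * ‖x 0‖ +
        ‖∑' k : ℕ, h ((n : ℤ) + k) • x (0 - k)‖ := by
  rw [hx.bestPredictor_sub_truncation hh hβ hf hφ, add_comm]
  exact (norm_add_le _ _).trans
    (add_le_add (hx.norm_tsum_futureFilter_le hβ hf hφ n) le_rfl)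

/-- Rates for absolutely summable filters. -/
lemma rates_of_summable_abs (hα : 0 ≤ α)
    (hψ : Summable fun j : ℕ => (1 + (j : ℝ)) ^ α * |maCoeff x j|)
    (hφ : Summable fun j : ℕ => (1 + (j : ℝ)) ^ α * |arCoeff x j|)
    (hh : Summable fun k : ℤ => |h k|) :
    IsLittleOAddBigO (sigmaTilde x h fun k => h k + futureFilter x h k)
        (fun n => (n : ℝ) ^ (-α)) (fun n => ∑' k : ℕ, |h ((n : ℤ) + k)|) ∧
      IsLittleOAddBigO (sigma x h)
        (fun n => (n : ℝ) ^ (-α)) (fun n => ∑' k : ℕ, |h ((n : ℤ) + k)|) := by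
  have hh2 := summable_sq_of_summable_abs hh
  have hf := summableFuture_of_summable_abs hα hh hψ
  have hbd : ∀ n : ℕ, ‖∑' k : ℕ, h ((n : ℤ) + k) • x (0 - k)‖ ≤
      (∑' k : ℕ, |h ((n : ℤ) + k)|) * ‖x 0‖ := fun n =>
    norm_tsum_smul_le (hh.comp_injective (i := fun k : ℕ => (n : ℤ) + k)
      fun a b hab => by simpa using hab) fun k => hx.norm_le _
  have hT := fun n => (hx.norm_truncation_error_le hh2 hα hf hφ n).trans
    (add_le_add le_rfl (hbd n))
  have hA := hf.futureFilter_isLittleO hα hφ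
  have hB : (fun n : ℕ => (∑' k : ℕ, |h ((n : ℤ) + k)|) * ‖x 0‖) =O[atTop]
      fun n : ℕ => ∑' k : ℕ, |h ((n : ℤ) + k)| :=
    ((isBigO_refl _ _).const_mul_left ‖x 0‖).congr_left fun n => mul_comm _ _
  have hB0 : ∀ n : ℕ, 0 ≤ (∑' k : ℕ, |h ((n : ℤ) + k)|) * ‖x 0‖ := fun n => by positivity
  constructor
  · refine isLittleOAddBigO_of_le (sigmaTilde_nonneg x h _) hB0 (fun n _ => ?_) hA hB
    rw [sigmaTilde_eq]
    exact (norm_bestPredictor_le _ _ _).trans (hT n)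
  · exact isLittleOAddBigO_of_le (sigma_nonneg x h) hB0
      (fun n _ => (sigma_le x h _ n).trans (hT n)) hA hB

/-- Rates for square summable filters. -/
lemma rates_of_summable_sq (hα : 1 ≤ α)
    (hψ : Summable fun j : ℕ => (1 + (j : ℝ)) ^ α * |maCoeff x j|)
    (hφ : Summable fun j : ℕ => (1 + (j : ℝ)) ^ α * |arCoeff x j|)
    (hh : Summable fun k => h k ^ 2) :
    IsLittleOAddBigO (sigmaTilde x h fun k => h k + futureFilter x h k)
        (fun n => (n : ℝ) ^ (-α + 1)) (fun n => ⨆ k : ℕ, |h ((n : ℤ) + k)|) ∧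
      IsLittleOAddBigO (sigma x h) (fun n => (n : ℝ) ^ (-α + 1))
        (fun n => Real.sqrt (∑' k : ℕ, h ((n : ℤ) + k) ^ 2)) := by
  have hα' : 0 ≤ α - 1 := by linarith
  have hφ' := summable_weight_mono (sub_le_self α zero_le_one) hφ
  have hf := summableFuture_of_summable_sq hα hh hψ
  have hA := hf.futureFilter_isLittleO hα' hφ'
  rw [neg_sub, sub_eq_neg_add] at hA
  have hhn : ∀ n : ℕ, Summable fun k : ℕ => h ((n : ℤ) + k) ^ 2 := fun n =>
    hh.comp_injective (i := fun k : ℕ => (n : ℤ) + k) fun a b hab => by simpa using hab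
  constructor
  -- The tail of `h` is bounded after projection onto `V_{[1,n]}`, where its supremum suffices; for
  -- `sigma` the unprojected tail enters, hence the `ℓ²` norm.
  · obtain ⟨C, hC0, hC⟩ := hx.exists_norm_bestPredictor_Icc_le (summable_weight_mono hα hψ)
    have hbdd : ∀ n : ℕ, BddAbove (Set.range fun k : ℕ => |h ((n : ℤ) + k)|) := fun n =>
      ⟨Real.sqrt (∑' k, h k ^ 2), by
        rintro _ ⟨k, rfl⟩
        exact abs_le_of_summable_sq hh _⟩
    have hsup0 : ∀ n : ℕ, 0 ≤ ⨆ k : ℕ, |h ((n : ℤ) + k)| := fun n =>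
      Real.iSup_nonneg fun _ => abs_nonneg _
    refine isLittleOAddBigO_of_le (B := fun n : ℕ => C * ⨆ k : ℕ, |h ((n : ℤ) + k)|)
      (sigmaTilde_nonneg x h _) (fun n => mul_nonneg hC0 (hsup0 n)) (fun n _ => ?_) hA
      ((isBigO_refl _ _).const_mul_left C)
    have h₁ := hC (fun k : ℕ => h ((n : ℤ) + k)) _ (hhn n) (fun k => le_ciSup (hbdd n) k) n
    have h₂ := (norm_bestPredictor_le x (Set.Icc 1 (n : ℤ)) _).trans
      (hx.norm_tsum_futureFilter_le hα' hf hφ' n)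
    rw [sigmaTilde_eq, hx.bestPredictor_sub_truncation hh hα' hf hφ', bestPredictor, map_add,
      add_comm]
    exact (norm_add_le _ _).trans (add_le_add h₂ h₁)
  · refine isLittleOAddBigO_of_le (B := fun n : ℕ => (∑' j, |maCoeff x j|) *
      (Real.sqrt (∑' k : ℕ, h ((n : ℤ) + k) ^ 2) * ‖innovation x 0‖))
      (sigma_nonneg x h) (fun n => by positivity) (fun n _ => ?_) hA ?_
    · refine ((sigma_le x h _ n).trans (hx.norm_truncation_error_le hh hα' hf hφ' n)).trans
        (add_le_add le_rfl ?_)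
      exact hx.norm_tsum_le (f := fun k : ℕ => (0 : ℤ) - k)
        (fun a b hab => by simpa using hab) (hhn n)
    · refine ((isBigO_refl _ _).const_mul_left
        ((∑' j, |maCoeff x j|) * ‖innovation x 0‖)).congr_left fun n => ?_
      ring

end IsRegularSeq

/-! ### From the process to the Hilbert space sequence. -/

section Realization

variable {Ω : Type*} [MeasurableSpace Ω] {P : Measure Ω} {X : ℤ → Ω → ℝ}

lemma IsCenteredStationary.inner_toL2 [IsProbabilityMeasure P] (hX : IsCenteredStationary P X)
    (s t : ℤ) : inner ℝ (hX.toL2 s) (hX.toL2 t) = cov[X s, X t; P] := by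
  rw [covariance_eq_sub (hX.memLp s) (hX.memLp t), hX.mean_zero, zero_mul, sub_zero, L2.inner_def]
  refine integral_congr_ae ?_
  filter_upwards [(hX.memLp s).coeFn_toLp, (hX.memLp t).coeFn_toLp] with ω h₁ h₂
  simp only [IsCenteredStationary.toL2, h₁, h₂, Pi.mul_apply]
  exact mul_comm _ _

lemma IsCenteredStationary.isRegularSeq [IsProbabilityMeasure P] (hX : IsCenteredStationary P X)
    (hvar : 0 < Var[X 0; P]) (hα : 0 ≤ α) (hSM : IsShortMemory hX.toL2 α) :
    IsRegularSeq hX.toL2 where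
  stationary s t r := by rw [hX.inner_toL2, hX.inner_toL2, hX.cov_shift]
  nondeterministic := hSM.purelyNondeterministic
  ne_zero h0 := by
    have h := hX.inner_toL2 0 0
    rw [h0, inner_zero_left, covariance_self (hX.memLp 0).aemeasurable] at h
    exact hvar.ne h
  summable_ma := summable_of_weight hα hSM.summable_ma
  summable_ar := summable_of_weight hα hSM.summable_ar

end Realization

end Main

end CausalFilter

end

theorem theorem3p4 {Ω : Type*} [MeasurableSpace Ω] (P : Measure Ω) [IsProbabilityMeasure P]
    (X : ℤ → Ω → ℝ) (hX : CausalFilter.IsCenteredStationary P X) (hvar : 0 < Var[X 0; P])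
    (α : ℝ) (hα : 0 ≤ α) (hSM : CausalFilter.IsShortMemory hX.toL2 α) (h : ℤ → ℝ) :
    ((Summable fun k : ℤ => |h k|) →
      (∀ n : ℕ, 1 ≤ n → Summable fun k : ℤ => h k • hX.toL2 ((n : ℤ) - k)) ∧
      (∃! g : ℕ → ℝ, CausalFilter.IsOptimalCausalFilter hX.toL2 h g) ∧
      (∀ g : ℕ → ℝ, CausalFilter.IsOptimalCausalFilter hX.toL2 h g →
        CausalFilter.IsLittleOAddBigO (CausalFilter.sigmaTilde hX.toL2 h g)
          (fun n => (n : ℝ) ^ (-α)) (fun n => ∑' k : ℕ, |h ((n : ℤ) + k)|)) ∧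
      CausalFilter.IsLittleOAddBigO (CausalFilter.sigma hX.toL2 h)
        (fun n => (n : ℝ) ^ (-α)) (fun n => ∑' k : ℕ, |h ((n : ℤ) + k)|)) ∧
    (1 ≤ α → (Summable fun k : ℤ => h k ^ 2) →
      (∀ n : ℕ, 1 ≤ n → Summable fun k : ℤ => h k • hX.toL2 ((n : ℤ) - k)) ∧
      (∃! g : ℕ → ℝ, CausalFilter.IsOptimalCausalFilter hX.toL2 h g) ∧
      (∀ g : ℕ → ℝ, CausalFilter.IsOptimalCausalFilter hX.toL2 h g →
        CausalFilter.IsLittleOAddBigO (CausalFilter.sigmaTilde hX.toL2 h g)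
          (fun n => (n : ℝ) ^ (-α + 1)) (fun n => ⨆ k : ℕ, |h ((n : ℤ) + k)|)) ∧
      CausalFilter.IsLittleOAddBigO (CausalFilter.sigma hX.toL2 h)
        (fun n => (n : ℝ) ^ (-α + 1))
        (fun n => Real.sqrt (∑' k : ℕ, h ((n : ℤ) + k) ^ 2))) := by
  have hx := hX.isRegularSeq hvar hα hSM
  have hψ := hSM.summable_ma
  have hφ := hSM.summable_ar
  refine ⟨fun hh => ?_, fun hα1 hh => ?_⟩
  · have hh2 := CausalFilter.summable_sq_of_summable_abs hh
    obtain ⟨hopt, huniq⟩ := hx.existsUnique_filter hh2 hα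
      (CausalFilter.summableFuture_of_summable_abs hα hh hψ) hφ
    have hr := hx.rates_of_summable_abs hα hψ hφ hh
    refine ⟨fun n _ => hx.summable_target hh2 n, ⟨_, hopt, huniq⟩, fun g hg => ?_, hr.2⟩
    rw [huniq g hg]
    exact hr.1
  · obtain ⟨hopt, huniq⟩ := hx.existsUnique_filter hh (by linarith : 0 ≤ α - 1)
      (CausalFilter.summableFuture_of_summable_sq hα1 hh hψ)
      (CausalFilter.summable_weight_mono (sub_le_self α zero_le_one) hφ)
    have hr := hx.rates_of_summable_sq hα1 hψ hφ hh
    refine ⟨fun n _ => hx.summable_target hh n, ⟨_, hopt, huniq⟩, fun g hg => ?_, hr.2⟩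
    rw [huniq g hg]
    exact hr.1
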